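/- Let $m\ge 1$ be an integer and let $(a_n)_{n\ge1}$ be complex numbers. Suppose that the Dirichlet series $\sum_{n\ge1} a_n n^{-s}$ belongs to $\mathcal H^m_\infty$, that is: (i) it is $m$-homogeneous: $a_n\neq 0$ only if $n$ is a product of exactly $m$ primes counted with multiplicity (i.e. $n=\mathfrak p^{\alpha}=\prod_k p_k^{\alpha_k}$ with $|\alpha|=\sum_k\alpha_k=m$, where $\mathfrak p=(p_k)$ is the sequence of primes); (ii) it converges at every $s\in\mathbb C$ with $\operatorname{Re}s>0$, and its sum $D(s)=\sum_{n=1}^\infty a_n n^{-s}$ is bounded on $\{\operatorname{Re}s>0\}$. Then $(a_n)$ is bounded and its non-increasing rearrangement $(a_k^*)_{k\ge1}$, $a_k^*=\inf\{\lambda>0:\ \operatorname{card}\{n:|a_n|>\lambda\}\le k-1\}$, lies in the Lorentz sequence space $\ell_{\frac{2m}{m+1},1}$; equivalently, $(a_n)$ itself lies in $\ell_{\frac{2m}{m+1},1}$. Here, for $1\le p<\infty$, $\ell_{p,1}$ is the space of all bounded families $x$ of complex numbers with $$\|x\|_{\ell_{p,1}}=\sum_{k\ge1}x_k^*\,\bigl(k^{1/p}-(k-1)^{1/p}\bigr)<\infty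 .$$ -/

import Mathlib

open Filter Topology

/-- The non-increasing rearrangement `x*` of a bounded family `x = (x i)`, numbered from zero:
`decreasingRearrangement x k` is the `(k+1)`-st largest value of `‖x i‖`, that is
`x*_{k+1} = inf {r > 0 : card {i : ‖x i‖ > r} ≤ k}`. -/
noncomputable def decreasingRearrangement {I E : Type*} [Norm E] (x : I → E) (k : ℕ) : ℝ :=
  sInf {r : ℝ | 0 < r ∧ {i : I | r < ‖x i‖}.encard ≤ (k : ℕ∞)}

/-- `x` belongs to the Lorentz sequence space `ℓ_{p,1}(I)` (with `0 < p < ∞`): the family is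
bounded and `‖x‖_{p,1} = ∑_{k ≥ 1} x*_k (k^{1/p} - (k-1)^{1/p})` is finite.
If `I` is finite then `x*_k = 0` for `k > card I`, so the series is the usual finite sum. -/
def MemLorentzOne {I E : Type*} [Norm E] (p : ℝ) (x : I → E) : Prop :=
  (∃ C : ℝ, ∀ i, ‖x i‖ ≤ C) ∧
    Summable fun k : ℕ =>
      decreasingRearrangement x k * (((k : ℝ) + 1) ^ (1 / p) - (k : ℝ) ^ (1 / p))

/-- The Dirichlet series `∑ a_n n^{-s}` is `m`-homogeneous: `a_n ≠ 0` only if `n = 𝔭^α` for a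
multi-index `α` of order `|α| = m`, where `𝔭 = (2, 3, 5, …)` is the sequence of primes. -/
def IsHomogeneousDirichlet (m : ℕ) (a : ℕ+ → ℂ) : Prop :=
  ∀ n : ℕ+, a n ≠ 0 → ∃ α : ℕ →₀ ℕ,
    (α.sum fun _ e => e) = m ∧ (n : ℕ) = α.prod fun k e => Nat.nth Nat.Prime k ^ e

/-- The Dirichlet series `∑ a_n n^{-s}` belongs to `H^m_∞`: it is `m`-homogeneous, its partial
sums converge at every point of the half-plane `Re s > 0`, and the sum is bounded there. -/
def MemHomogeneousHInfty (m : ℕ) (a : ℕ+ → ℂ) : Prop :=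
  IsHomogeneousDirichlet m a ∧
    ∃ D : ℂ → ℂ,
      (∀ s : ℂ, 0 < s.re →
        Tendsto (fun N : ℕ+ => ∑ n ∈ Finset.Icc 1 N, a n / (n : ℂ) ^ s) atTop (𝓝 (D s))) ∧
      ∃ C : ℝ, ∀ s : ℂ, 0 < s.re → ‖D s‖ ≤ C

/-! Under Bohr's correspondence, which replaces each prime by an independent variable, the series
becomes an `m`-homogeneous polynomial `P`. For a finite set `A` of primes let `L q` be the `ℓ²` norm
of the coefficients of `z_q ∂_q P`, where `P` is restricted to the variables in `A`. Two facts give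
the theorem.

Analytic part (`sum_sqrt_sum_sq_le`): `∑ q ∈ A, L q` is bounded independently of `A`. By Khinchine's
inequality (`exists_tendsto_le_symmMean_norm`, from a fourth moment), `L q` is at most `2^(m+2)`
times the mean of `|z_q ∂_q P|`. Pointwise, `∑ |z_q ∂_q P|` is controlled by the sums over subsets
`B ⊆ A`. Such a sum is the derivative at `z = 1` of the polynomial obtained by rotating only the
variables in `B` by `z`, so a Bernstein inequality applies. That `P` is bounded on the torus is
`norm_sum_twist_le`: the series is tested against the positive kernels `|∑ χ(g) g^{it}|²`, where `g`
runs over the divisors of `Q^M` and `Q` is the product of the primes in `A`. These act as Fejér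
kernels as `M → ∞`.

Combinatorial part (`sum_mul_weight_le`): the squared Lorentz weights over at most `N^m` ranks add
up to at most `m N`, and there are at most `N^m` monomials of degree `m` in `N` variables. Each
monomial contains at most `m` variables, so for some `q` the squared weights of the monomials
divisible by `q` add up to at most `m²`. Cauchy–Schwarz bounds the contribution of these monomials
by `m L q`; the variable `q` is then discarded and the argument repeated. -/

/-! ### Lorentz weights -/

/-- The weights `k^θ - (k-1)^θ` of the Lorentz norm decay at least like `k^(θ-1)`. -/
lemma rpow_succ_sub_rpow_le {θ : ℝ} (hθ : 0 < θ) (hθ1 : θ ≤ 1) (k : ℕ) :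
    ((k : ℝ) + 1) ^ θ - (k : ℝ) ^ θ ≤ ((k : ℝ) + 1) ^ (θ - 1) := by
  have h1 : ((k : ℝ) + 1) ^ θ = ((k : ℝ) + 1) * ((k : ℝ) + 1) ^ (θ - 1) := by
    rw [mul_comm, ← Real.rpow_add_one (by positivity)]; simp
  rcases Nat.eq_zero_or_pos k with rfl | hk
  · simp [Real.zero_rpow hθ.ne']
  have hk' : (0 : ℝ) < k := by exact_mod_cast hk
  have h2 : (k : ℝ) ^ θ = k * (k : ℝ) ^ (θ - 1) := by
    rw [mul_comm, ← Real.rpow_add_one hk'.ne']; simp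
  have h3 : ((k : ℝ) + 1) ^ (θ - 1) ≤ (k : ℝ) ^ (θ - 1) :=
    Real.rpow_le_rpow_of_nonpos hk' (by linarith) (by linarith)
  rw [h1, h2]
  nlinarith [mul_le_mul_of_nonneg_left h3 hk'.le]

lemma rpow_succ_sub_rpow_nonneg {θ : ℝ} (hθ : 0 < θ) (k : ℕ) :
    0 ≤ ((k : ℝ) + 1) ^ θ - (k : ℝ) ^ θ :=
  sub_nonneg.2 (Real.rpow_le_rpow (by positivity) (by linarith) hθ.le)

/-- Bernoulli's inequality for the concave power `δ` at `1 - 1/(n+1)`; it is the induction step of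
the next sum bound. -/
lemma rpow_add_mul_rpow_le {δ : ℝ} (hδ : 0 < δ) (hδ1 : δ ≤ 1) (n : ℕ) :
    (n : ℝ) ^ δ + δ * ((n : ℝ) + 1) ^ (δ - 1) ≤ ((n : ℝ) + 1) ^ δ := by
  have hn : (0 : ℝ) < (n : ℝ) + 1 := by positivity
  have hs : (-1 : ℝ) ≤ -(1 / ((n : ℝ) + 1)) := by
    rw [neg_le_neg_iff, div_le_one hn]; linarith [Nat.cast_nonneg (α := ℝ) n]
  have hB := rpow_one_add_le_one_add_mul_self hs hδ.le hδ1
  have h1 : (n : ℝ) = ((n : ℝ) + 1) * (1 + -(1 / ((n : ℝ) + 1))) := by field_simp; ring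
  have h2 : (n : ℝ) ^ δ = ((n : ℝ) + 1) ^ δ * (1 + -(1 / ((n : ℝ) + 1))) ^ δ := by
    conv_lhs => rw [h1]
    exact Real.mul_rpow hn.le (by linarith)
  have h3 : ((n : ℝ) + 1) ^ (δ - 1) = ((n : ℝ) + 1) ^ δ * (1 / ((n : ℝ) + 1)) := by
    rw [Real.rpow_sub_one hn.ne']; ring
  rw [h2, h3]
  nlinarith [mul_le_mul_of_nonneg_left hB (Real.rpow_nonneg hn.le δ)]

/-- The summand decreases in `k`, so an initial segment is the worst case. Adding the elements of
`T` in increasing order, each new `k` is at least the number of earlier ones. -/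
lemma sum_rpow_sub_one_le {δ : ℝ} (hδ : 0 < δ) (hδ1 : δ ≤ 1) (T : Finset ℕ) :
    δ * ∑ k ∈ T, ((k : ℝ) + 1) ^ (δ - 1) ≤ (T.card : ℝ) ^ δ := by
  induction T using Finset.induction_on_max with
  | empty => simp [Real.zero_rpow hδ.ne']
  | insert k T hk ih =>
    have hkT : k ∉ T := fun h => lt_irrefl _ (hk k h)
    have hcard : T.card ≤ k := by
      simpa using Finset.card_le_card (fun x hx => Finset.mem_range.2 (hk x hx) : T ⊆ Finset.range k)
    rw [Finset.sum_insert hkT, Finset.card_insert_of_notMem hkT, mul_add, Nat.cast_succ]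
    have h1 := rpow_add_mul_rpow_le hδ hδ1 T.card
    have h2 : ((k : ℝ) + 1) ^ (δ - 1) ≤ ((T.card : ℝ) + 1) ^ (δ - 1) :=
      Real.rpow_le_rpow_of_nonpos (by positivity) (by gcongr) (by linarith)
    nlinarith

/-- The squares of the weights of `ℓ_{p,1}`, `p = 2m/(m+1)`, summed over a set of ranks. -/
lemma sum_weight_sq_le {m : ℕ} (hm : 1 ≤ m) (T : Finset ℕ) {N : ℕ} (hT : T.card ≤ N ^ m) :
    ∑ k ∈ T, (((k : ℝ) + 1) ^ (1 / (2 * (m : ℝ) / ((m : ℝ) + 1)))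
      - (k : ℝ) ^ (1 / (2 * (m : ℝ) / ((m : ℝ) + 1)))) ^ 2 ≤ (m : ℝ) * N := by
  have hm' : (1 : ℝ) ≤ m := by exact_mod_cast hm
  set θ : ℝ := 1 / (2 * (m : ℝ) / ((m : ℝ) + 1)) with hθ
  have hθe : θ = (m + 1) / (2 * m) := by rw [hθ]; field_simp
  have hθ0 : 0 < θ := by rw [hθe]; positivity
  have hθ1 : θ ≤ 1 := by rw [hθe, div_le_one (by positivity)]; linarith
  have hδ0 : (0 : ℝ) < 1 / m := by positivity
  have hδ1 : (1 : ℝ) / m ≤ 1 := by rw [div_le_one (by positivity)]; exact hm'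
  have hle : ∀ k ∈ T, (((k : ℝ) + 1) ^ θ - (k : ℝ) ^ θ) ^ 2 ≤ ((k : ℝ) + 1) ^ ((1 : ℝ) / m - 1) := by
    intro k _
    -- The exponent `θ = (m+1)/(2m)` satisfies `2(θ - 1) = 1/m - 1`.
    calc (((k : ℝ) + 1) ^ θ - (k : ℝ) ^ θ) ^ 2 ≤ (((k : ℝ) + 1) ^ (θ - 1)) ^ 2 :=
          pow_le_pow_left₀ (rpow_succ_sub_rpow_nonneg hθ0 k) (rpow_succ_sub_rpow_le hθ0 hθ1 k) 2
      _ = ((k : ℝ) + 1) ^ ((1 : ℝ) / m - 1) := by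
          rw [← Real.rpow_natCast, ← Real.rpow_mul (by positivity)]
          congr 1
          rw [hθe]; field_simp; push_cast; ring
  have h1 := sum_rpow_sub_one_le hδ0 hδ1 T
  have h2 : (T.card : ℝ) ^ ((1 : ℝ) / m) ≤ N := by
    calc (T.card : ℝ) ^ ((1 : ℝ) / m) ≤ ((N : ℝ) ^ m) ^ ((1 : ℝ) / m) :=
          Real.rpow_le_rpow (by positivity) (by exact_mod_cast hT) hδ0.le
      _ = N := by
          rw [one_div]; exact Real.pow_rpow_inv_natCast (by positivity) (by omega)
  have h3 : ∑ k ∈ T, ((k : ℝ) + 1) ^ ((1 : ℝ) / m - 1) ≤ m * N := by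
    have := h1.trans h2
    rw [one_div_mul_eq_div, div_le_iff₀ (by positivity)] at this
    linarith
  exact (Finset.sum_le_sum hle).trans h3

/-! ### Peeling off one prime at a time -/

open ArithmeticFunction in
/-- There are at most `|A|^m` products of `m` elements of `A`. -/
lemma card_le_pow_of_primeFactors_subset {m : ℕ} (A S : Finset ℕ)
    (hS : ∀ n ∈ S, n ≠ 0 ∧ cardFactors n = m ∧ n.primeFactors ⊆ A) : S.card ≤ A.card ^ m := by
  have h : S ⊆ (Fintype.piFinset fun _ : Fin m => A).image fun g => ∏ i, g i := by
    intro n hn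
    obtain ⟨h0, h1, h2⟩ := hS n hn
    rw [cardFactors_apply] at h1
    rw [Finset.mem_image]
    refine ⟨fun i => n.primeFactorsList.get (i.cast h1.symm), ?_, ?_⟩
    · rw [Fintype.mem_piFinset]
      intro i
      exact h2 (Nat.mem_primeFactors_iff_mem_primeFactorsList.2 (List.get_mem _ _))
    · subst h1
      conv_rhs => rw [← Nat.prod_primeFactorsList h0]
      simp [Fin.prod_univ_getElem]
  refine (Finset.card_le_card h).trans (Finset.card_image_le.trans ?_)
  simp

open ArithmeticFunction in
/-- A greedy peeling argument: a sequence weighted by the Lorentz weights is controlled by the sum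
of the `ℓ²` norms of its restrictions to the multiples of `q`, `q ∈ A`. -/
lemma sum_mul_weight_le {m : ℕ} (hm : 1 ≤ m) (n : ℕ → ℕ) (x L : ℕ → ℝ)
    (A : Finset ℕ) (hAp : ∀ q ∈ A, q.Prime) (T : Finset ℕ) (hinj : Set.InjOn n T)
    (hn : ∀ k ∈ T, n k ≠ 0 ∧ cardFactors (n k) = m ∧ (n k).primeFactors ⊆ A)
    (hL0 : ∀ q ∈ A, 0 ≤ L q)
    (hL : ∀ q ∈ A, ∑ k ∈ T with q ∣ n k, x k ^ 2 ≤ L q ^ 2) :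
    ∑ k ∈ T, x k * (((k : ℝ) + 1) ^ (1 / (2 * (m : ℝ) / ((m : ℝ) + 1)))
      - (k : ℝ) ^ (1 / (2 * (m : ℝ) / ((m : ℝ) + 1)))) ≤ m * ∑ q ∈ A, L q := by
  set w : ℕ → ℝ := fun k => ((k : ℝ) + 1) ^ (1 / (2 * (m : ℝ) / ((m : ℝ) + 1)))
      - (k : ℝ) ^ (1 / (2 * (m : ℝ) / ((m : ℝ) + 1))) with hw
  change ∑ k ∈ T, x k * w k ≤ _
  -- The ranks in `T` keep their original numbering when `T` shrinks: the weight bound depends only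
  -- on the cardinality of `T`.
  induction hA : A.card generalizing A T with
  | zero =>
    rw [Finset.card_eq_zero] at hA
    subst hA
    have : T = ∅ := by
      refine Finset.eq_empty_of_forall_notMem fun k hk => ?_
      obtain ⟨h0, h1, h2⟩ := hn k hk
      rw [Finset.subset_empty, Nat.primeFactors_eq_empty] at h2
      rcases h2 with h2 | h2
      · exact h0 h2
      · rw [h2, cardFactors_one] at h1; omega
    simp [this]
  | succ N ih =>
    have hcard : T.card ≤ A.card ^ m := by
      rw [← Finset.card_image_of_injOn hinj]
      refine card_le_pow_of_primeFactors_subset A _ fun j hj => ?_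
      obtain ⟨k, hk, rfl⟩ := Finset.mem_image.1 hj
      exact hn k hk
    -- Double counting: each `k` occurs for at most `m` primes `q`, and the squared weights over `T`
    -- add up to at most `m` times the cardinality of `A`.
    have hsum : ∑ q ∈ A, ∑ k ∈ T with q ∣ n k, w k ^ 2 ≤ ∑ q ∈ A, (m : ℝ) ^ 2 := by
      calc ∑ q ∈ A, ∑ k ∈ T with q ∣ n k, w k ^ 2
          = ∑ q ∈ A, ∑ k ∈ T, if q ∣ n k then w k ^ 2 else 0 := by simp [Finset.sum_filter]
        _ = ∑ k ∈ T, ∑ q ∈ A, if q ∣ n k then w k ^ 2 else 0 := Finset.sum_comm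
        _ ≤ ∑ k ∈ T, m * w k ^ 2 := by
            refine Finset.sum_le_sum fun k hk => ?_
            rw [← Finset.sum_filter, Finset.sum_const, nsmul_eq_mul]
            refine mul_le_mul_of_nonneg_right ?_ (sq_nonneg _)
            obtain ⟨h0, h1, -⟩ := hn k hk
            rw [← h1, cardFactors_apply]
            refine Nat.cast_le.2 ((Finset.card_le_card fun q hq => ?_).trans
              (List.toFinset_card_le (n k).primeFactorsList))
            obtain ⟨hqA, hqd⟩ := Finset.mem_filter.1 hq
            exact List.mem_toFinset.2 ((Nat.mem_primeFactorsList h0).2 ⟨hAp q hqA, hqd⟩)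
        _ ≤ m * (m * A.card) := by
            rw [← Finset.mul_sum]
            gcongr
            exact sum_weight_sq_le hm T hcard
        _ = _ := by rw [Finset.sum_const, nsmul_eq_mul]; ring
    have hne : A.Nonempty := Finset.card_pos.1 (by omega)
    obtain ⟨q, hq, hqle⟩ := Finset.exists_le_of_sum_le hne hsum
    have h1 : ∑ k ∈ T with q ∣ n k, x k * w k ≤ m * L q := by
      refine (Real.sum_mul_le_sqrt_mul_sqrt _ _ _).trans ?_
      have e1 : √(∑ k ∈ T with q ∣ n k, x k ^ 2) ≤ L q :=
        Real.sqrt_le_iff.2 ⟨hL0 q hq, hL q hq⟩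
      have e2 : √(∑ k ∈ T with q ∣ n k, w k ^ 2) ≤ m :=
        Real.sqrt_le_iff.2 ⟨by positivity, hqle⟩
      calc _ ≤ L q * m := mul_le_mul e1 e2 (Real.sqrt_nonneg _) (hL0 q hq)
        _ = _ := mul_comm _ _
    have h2 := ih (A.erase q) (fun p hp => hAp p (Finset.mem_of_mem_erase hp)) (T.filter fun k => ¬ q ∣ n k)
      (hinj.mono (Finset.coe_subset.2 (Finset.filter_subset _ _)))
      (fun k hk => by
        obtain ⟨hk1, hk2⟩ := Finset.mem_filter.1 hk
        obtain ⟨a, b, c⟩ := hn k hk1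
        refine ⟨a, b, fun p hp => Finset.mem_erase.2 ⟨?_, c hp⟩⟩
        rintro rfl
        exact hk2 (Nat.dvd_of_mem_primeFactors hp))
      (fun p hp => hL0 p (Finset.mem_of_mem_erase hp))
      (fun p hp => (Finset.sum_le_sum_of_subset_of_nonneg
        (Finset.filter_subset_filter _ (Finset.filter_subset _ _))
        (fun _ _ _ => sq_nonneg _)).trans (hL p (Finset.mem_of_mem_erase hp)))
      (by rw [Finset.card_erase_of_mem hq, hA]; rfl)
    rw [← Finset.sum_filter_add_sum_filter_not T (fun k => q ∣ n k), ← Finset.add_sum_erase A L hq,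
      mul_add]
    exact add_le_add h1 h2

/-! ### Non-increasing rearrangements -/

section Rearrangement

variable {I E : Type*} [Norm E]

lemma decreasingRearrangement_nonneg (x : I → E) (k : ℕ) : 0 ≤ decreasingRearrangement x k :=
  Real.sInf_nonneg fun _ hr => hr.1.le

lemma decreasingRearrangement_le {x : I → E} {k : ℕ} {r : ℝ} (hr : 0 < r)
    (h : {i : I | r < ‖x i‖}.encard ≤ (k : ℕ∞)) : decreasingRearrangement x k ≤ r :=
  csInf_le ⟨0, fun _ hr => hr.1.le⟩ ⟨hr, h⟩

/-- Outside any set of `k` indices there are entries almost as large as the `(k+1)`-st one. -/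
lemma exists_notMem_lt_norm [Infinite I] {x : I → E} (hx : ∀ i, 0 ≤ ‖x i‖) {k : ℕ} {r : ℝ}
    (hr : r < decreasingRearrangement x k) {F : Finset I} (hF : F.card ≤ k) :
    ∃ i, i ∉ F ∧ r < ‖x i‖ := by
  rcases lt_or_ge r 0 with hr0 | hr0
  · obtain ⟨i, hi⟩ := Infinite.exists_notMem_finset F
    exact ⟨i, hi, hr0.trans_le (hx i)⟩
  -- The threshold in the definition must be positive, whereas `r` may be `0`.
  obtain ⟨s, hrs, hs⟩ := exists_between hr
  by_contra! hcon
  refine absurd (decreasingRearrangement_le (hr0.trans_lt hrs) ?_) (not_le.2 hs)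
  have hsub : {i : I | s < ‖x i‖} ⊆ F := fun i hi => by
    by_contra hiF
    exact absurd (hrs.trans hi) (not_lt.2 (hcon i hiF))
  calc _ ≤ (F : Set I).encard := Set.encard_le_encard hsub
    _ = F.card := Set.encard_coe_eq_coe_finsetCard F
    _ ≤ k := by exact_mod_cast hF

/-- Greedy choice: fewer than `k + 1` indices have been used before step `k`. The strict inequality
leaves room for rearrangement values that are not attained. -/
lemma exists_injOn_lt_norm [Infinite I] {x : I → E} (hx : ∀ i, 0 ≤ ‖x i‖) {r : ℕ → ℝ}
    (hr : ∀ k, r k < decreasingRearrangement x k) (K : ℕ) :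
    ∃ n : ℕ → I, Set.InjOn n (Finset.range K) ∧ ∀ k < K, r k < ‖x (n k)‖ := by
  classical
  induction K with
  | zero => exact ⟨fun _ => Classical.arbitrary I, by simp, by simp⟩
  | succ K ih =>
    obtain ⟨n, hn, hlt⟩ := ih
    obtain ⟨i, hi, hri⟩ := exists_notMem_lt_norm hx (hr K)
      (F := (Finset.range K).image n) (Finset.card_image_le.trans (by simp))
    have hne : ∀ k < K, n k ≠ i := fun k hk h =>
      hi (Finset.mem_image.2 ⟨k, Finset.mem_range.2 hk, h⟩)
    refine ⟨Function.update n K i, ?_, ?_⟩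
    · intro k hk l hl hkl
      simp only [Finset.coe_range, Set.mem_Iio] at hk hl
      rcases (Nat.lt_succ_iff_lt_or_eq.1 hk) with hk | rfl <;>
      rcases (Nat.lt_succ_iff_lt_or_eq.1 hl) with hl | rfl
      · rw [Function.update_of_ne hk.ne, Function.update_of_ne hl.ne] at hkl
        exact hn (by simpa using hk) (by simpa using hl) hkl
      · rw [Function.update_of_ne hk.ne, Function.update_self] at hkl
        exact absurd hkl (hne k hk)
      · rw [Function.update_of_ne hl.ne, Function.update_self] at hkl
        exact absurd hkl.symm (hne l hl)
      · rfl
    · intro k hk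
      rcases (Nat.lt_succ_iff_lt_or_eq.1 hk) with hk | rfl
      · rw [Function.update_of_ne hk.ne]; exact hlt k hk
      · rw [Function.update_self]; exact hri

/-- Criterion for membership in `ℓ_{p,1}` by testing on finite sequences of distinct indices. -/
lemma memLorentzOne_of_forall_sum_le [Infinite I] {x : I → E} (hx : ∀ i, 0 ≤ ‖x i‖) {p : ℝ}
    (hp : 0 < p) {C R : ℝ} (hC : ∀ i, ‖x i‖ ≤ C)
    (h : ∀ (K : ℕ) (n : ℕ → I), Set.InjOn n (Finset.range K) →
      ∑ k ∈ Finset.range K, ‖x (n k)‖ * (((k : ℝ) + 1) ^ (1 / p) - (k : ℝ) ^ (1 / p)) ≤ R) :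
    MemLorentzOne p x := by
  have hw := rpow_succ_sub_rpow_nonneg (one_div_pos.2 hp)
  refine ⟨⟨C, hC⟩, summable_of_sum_range_le (c := R)
    (fun k => mul_nonneg (decreasingRearrangement_nonneg x k) (hw k)) fun K => ?_⟩
  set W := ∑ k ∈ Finset.range K, (((k : ℝ) + 1) ^ (1 / p) - (k : ℝ) ^ (1 / p)) with hW
  have hW0 : 0 ≤ W := Finset.sum_nonneg fun k _ => hw k
  refine le_of_forall_pos_le_add fun ε hε => ?_
  set δ := ε / (W + 1) with hδ
  have hδ0 : 0 < δ := by positivity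
  obtain ⟨n, hn, hlt⟩ := exists_injOn_lt_norm hx
    (r := fun k => decreasingRearrangement x k - δ) (fun k => by linarith) K
  calc ∑ k ∈ Finset.range K, decreasingRearrangement x k * _
      ≤ ∑ k ∈ Finset.range K, (‖x (n k)‖ * (((k : ℝ) + 1) ^ (1 / p) - (k : ℝ) ^ (1 / p))
          + δ * (((k : ℝ) + 1) ^ (1 / p) - (k : ℝ) ^ (1 / p))) := by
        refine Finset.sum_le_sum fun k hk => ?_
        rw [← add_mul]
        exact mul_le_mul_of_nonneg_right (by linarith [hlt k (Finset.mem_range.1 hk)]) (hw k)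
    _ ≤ R + δ * W := by
        rw [Finset.sum_add_distrib, ← Finset.mul_sum]
        exact add_le_add_left (h K n hn) _
    _ ≤ R + ε := by
        have : δ * W ≤ δ * (W + 1) := by gcongr; linarith
        rw [hδ, div_mul_cancel₀ _ (by positivity)] at this
        linarith

lemma decreasingRearrangement_antitone_of_bounded {x : I → E} {C : ℝ} (hC : ∀ i, ‖x i‖ ≤ C) :
    Antitone (decreasingRearrangement x) := by
  intro k l hkl
  -- Boundedness makes the set of thresholds for `k` nonempty; otherwise the junk value `sInf ∅ = 0`
  -- could break monotonicity.
  refine csInf_le_csInf ⟨0, fun _ hr => hr.1.le⟩ ⟨max C 1, by positivity, ?_⟩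
    fun r hr => ⟨hr.1, hr.2.trans (by exact_mod_cast hkl)⟩
  have : {i : I | max C 1 < ‖x i‖} = ∅ :=
    Set.eq_empty_of_forall_notMem fun i hi =>
      absurd ((le_max_left C 1).trans_lt hi) (not_lt.2 (hC i))
  rw [this]
  simp

/-- The rearrangement of a member of `ℓ_{p,1}` is again a member. -/
lemma MemLorentzOne.decreasingRearrangement {x : I → E} {p : ℝ} (hp : 0 < p)
    (h : MemLorentzOne p x) : MemLorentzOne p (decreasingRearrangement x) := by
  obtain ⟨⟨C, hC⟩, hs⟩ := h
  have hanti := decreasingRearrangement_antitone_of_bounded hC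
  have hw := rpow_succ_sub_rpow_nonneg (one_div_pos.2 hp)
  have habs : ∀ j, ‖_root_.decreasingRearrangement x j‖ = _root_.decreasingRearrangement x j :=
    fun j => by rw [Real.norm_eq_abs, abs_of_nonneg (decreasingRearrangement_nonneg x j)]
  refine ⟨⟨_root_.decreasingRearrangement x 0, fun j => (habs j).trans_le (hanti (Nat.zero_le j))⟩,
    hs.of_nonneg_of_le (fun k => mul_nonneg (decreasingRearrangement_nonneg _ k) (hw k))
      fun k => mul_le_mul_of_nonneg_right ?_ (hw k)⟩
  refine le_of_forall_pos_le_add fun ε hε => decreasingRearrangement_le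
    (by linarith [decreasingRearrangement_nonneg x k]) ?_
  -- By monotonicity only ranks below `k` can exceed the `k`-th value, so rearranging twice does not
  -- increase anything.
  have hsub : {j : ℕ | _root_.decreasingRearrangement x k + ε < ‖_root_.decreasingRearrangement x j‖}
      ⊆ (Finset.range k : Set ℕ) := fun j hj => by
    rw [Finset.coe_range, Set.mem_Iio]
    by_contra! hkj
    have := hanti hkj
    have hj' : _ < ‖_root_.decreasingRearrangement x j‖ := hj
    rw [habs] at hj'
    linarith
  calc _ ≤ (Finset.range k : Set ℕ).encard := Set.encard_le_encard hsub
    _ = k := by rw [Set.encard_coe_eq_coe_finsetCard]; simp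

end Rearrangement

/-! ### Convergent Dirichlet series are holomorphic -/

/-- `natExp s n = n^{-s}`, for `n ≥ 1`. -/
noncomputable def natExp (s : ℂ) (n : ℕ) : ℂ := Complex.exp (-(s * (Real.log n : ℝ)))

lemma norm_natExp (s : ℂ) (n : ℕ) : ‖natExp s n‖ = Real.exp (-(s.re * Real.log n)) := by
  rw [natExp, Complex.norm_exp, Complex.neg_re, Complex.re_mul_ofReal]

lemma natExp_add (s w : ℂ) (n : ℕ) : natExp (s + w) n = natExp s n * natExp w n := by
  rw [natExp, natExp, natExp, ← Complex.exp_add]; ring_nf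

lemma natExp_eq_inv_cpow (s : ℂ) {n : ℕ} (hn : n ≠ 0) : natExp s n = ((n : ℂ) ^ s)⁻¹ := by
  rw [natExp, Complex.cpow_def_of_ne_zero (by exact_mod_cast hn), ← Complex.exp_neg,
    ← Complex.natCast_log, mul_comm]

lemma differentiable_natExp (n : ℕ) : Differentiable ℂ fun s => natExp s n := by
  unfold natExp; fun_prop

lemma norm_natExp_eq_rpow (s : ℂ) {n : ℕ} (hn : n ≠ 0) : ‖natExp s n‖ = (n : ℝ) ^ (-s.re) := by
  rw [norm_natExp, Real.rpow_def_of_pos (by positivity)]; ring_nf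

/-- Mean value inequality for `x ↦ x^{-w}`, whose derivative has modulus `‖w‖ x^{-Re w - 1}`. -/
lemma norm_natExp_succ_sub_le {w : ℂ} (hw : 0 < w.re) (i : ℕ) :
    ‖natExp w (i + 1 + 1) - natExp w (i + 1)‖ ≤ ‖w‖ * ((i : ℝ) + 1) ^ (-w.re - 1) := by
  have hi : (0 : ℝ) < (i : ℝ) + 1 := by positivity
  have hder : ∀ x ∈ Set.Icc ((i : ℝ) + 1) ((i : ℝ) + 1 + 1),
      HasDerivWithinAt (fun x : ℝ => Complex.exp (-(w * (Real.log x : ℝ))))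
        (Complex.exp (-(w * (Real.log x : ℝ))) * (-(w * ((x⁻¹ : ℝ) : ℂ))))
        (Set.Icc ((i : ℝ) + 1) ((i : ℝ) + 1 + 1)) x := by
    intro x hx
    have hx0 : x ≠ 0 := (hi.trans_le hx.1).ne'
    exact (((Real.hasDerivAt_log hx0).ofReal_comp.const_mul w).fun_neg.cexp).hasDerivWithinAt
  have hb : ∀ x ∈ Set.Ico ((i : ℝ) + 1) ((i : ℝ) + 1 + 1),
      ‖Complex.exp (-(w * (Real.log x : ℝ))) * (-(w * ((x⁻¹ : ℝ) : ℂ)))‖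
        ≤ ‖w‖ * ((i : ℝ) + 1) ^ (-w.re - 1) := by
    intro x hx
    have hx0 : 0 < x := hi.trans_le hx.1
    have : ‖Complex.exp (-(w * (Real.log x : ℝ))) * (-(w * ((x⁻¹ : ℝ) : ℂ)))‖
        = ‖w‖ * x ^ (-w.re - 1) := by
      rw [norm_mul, Complex.norm_exp, norm_neg, norm_mul, Complex.norm_real, Real.norm_eq_abs,
        abs_of_pos (inv_pos.2 hx0), Real.rpow_sub_one hx0.ne', Real.rpow_def_of_pos hx0]
      simp; ring_nf
    rw [this]
    exact mul_le_mul_of_nonneg_left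
      (Real.rpow_le_rpow_of_nonpos hi hx.1 (by linarith)) (norm_nonneg w)
  have := norm_image_sub_le_of_norm_deriv_le_segment' hder hb ((i : ℝ) + 1 + 1)
    (Set.right_mem_Icc.2 (by linarith))
  rw [natExp, natExp, Nat.cast_succ, Nat.cast_succ]
  simpa only [add_sub_cancel_left, mul_one] using this

section DirichletSeries

variable {b : ℕ → ℂ} {D : ℂ → ℂ}

lemma tendsto_sum_succ (hb : b 0 = 0)
    (hD : ∀ s : ℂ, 0 < s.re →
      Tendsto (fun N : ℕ => ∑ n ∈ Finset.range N, b n * natExp s n) atTop (𝓝 (D s)))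
    {s : ℂ} (hs : 0 < s.re) :
    Tendsto (fun N : ℕ => ∑ n ∈ Finset.range N, b (n + 1) * natExp s (n + 1)) atTop
      (𝓝 (D s)) := by
  refine ((hD s hs).comp (tendsto_add_atTop_nat 1)).congr fun N => ?_
  simp [Finset.sum_range_succ', hb]

/-- The sum of a Dirichlet series converging on `Re s > 0` is holomorphic there. -/
lemma differentiableAt_of_tendsto (hb : b 0 = 0)
    (hD : ∀ s : ℂ, 0 < s.re →
      Tendsto (fun N : ℕ => ∑ n ∈ Finset.range N, b n * natExp s n) atTop (𝓝 (D s)))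
    {s : ℂ} (hs : 0 < s.re) : DifferentiableAt ℂ D s := by
  -- Abel summation against the bounded partial sums at `ε` turns the series at `ε + w` into one
  -- that is dominated by a summable sequence for `w` near `s - ε`.
  set ε : ℂ := ((s.re / 2 : ℝ) : ℂ) with hε
  have hεre : ε.re = s.re / 2 := by simp [hε]
  set G : ℕ → ℂ := fun N => ∑ n ∈ Finset.range N, b (n + 1) * natExp ε (n + 1) with hG
  obtain ⟨B, hB⟩ : ∃ B, ∀ N, ‖G N‖ ≤ B := by
    obtain ⟨B, hB⟩ := (tendsto_sum_succ hb hD (s := ε) (by rw [hεre]; positivity)).norm.bddAbove_range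
    exact ⟨B, fun N => hB ⟨N, rfl⟩⟩
  have hB0 : 0 ≤ B := (norm_nonneg _).trans (hB 0)
  set F : ℕ → ℂ → ℂ := fun i w => (natExp w (i + 1 + 1) - natExp w (i + 1)) * G (i + 1) with hF
  set U : Set ℂ := {w | s.re / 4 < w.re ∧ ‖w‖ < ‖s‖ + 1} with hU
  set u : ℕ → ℝ := fun i => (‖s‖ + 1) * ((i : ℝ) + 1) ^ (-(s.re / 4) - 1) * B with hu
  have hu_sum : Summable u := by
    refine Summable.mul_right _ (Summable.mul_left _ ?_)
    have := (summable_nat_add_iff 1).2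
      (Real.summable_nat_rpow (p := -(s.re / 4) - 1)|>.2 (by linarith))
    simpa using this
  have hFu : ∀ i w, w ∈ U → ‖F i w‖ ≤ u i := by
    intro i w hw
    rw [hF, norm_mul]
    refine mul_le_mul ((norm_natExp_succ_sub_le (by linarith [hw.1]) i).trans ?_) (hB _)
      (norm_nonneg _) (by positivity)
    refine mul_le_mul hw.2.le (Real.rpow_le_rpow_of_exponent_le ?_ ?_) (by positivity)
      (by positivity)
    · linarith [Nat.cast_nonneg (α := ℝ) i]
    · linarith [hw.1]
  have hUo : IsOpen U :=
    (isOpen_lt continuous_const Complex.continuous_re).inter (isOpen_lt continuous_norm continuous_const)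
  have hdiff : DifferentiableOn ℂ (fun w => ∑' i, F i w) U :=
    Complex.differentiableOn_tsum_of_summable_norm hu_sum
      (fun i => (((differentiable_natExp _).sub (differentiable_natExp _)).mul_const _).differentiableOn)
      hUo hFu
  have heq : ∀ w ∈ U, D (ε + w) = -∑' i, F i w := by
    intro w hw
    have hwre : 0 < w.re := by linarith [hw.1]
    have hsum : Summable fun i => F i w :=
      Summable.of_norm_bounded hu_sum fun i => hFu i w hw
    have h1 := tendsto_sum_succ hb hD (s := ε + w) (by rw [Complex.add_re, hεre]; linarith)
    have h2 : Tendsto (fun N : ℕ => natExp w (N + 1) * G (N + 1)) atTop (𝓝 0) := by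
      refine squeeze_zero_norm (a := fun N : ℕ => ((N + 1 : ℕ) : ℝ) ^ (-w.re) * B) (fun N => ?_) ?_
      · rw [norm_mul, norm_natExp_eq_rpow _ (Nat.succ_ne_zero N)]
        exact mul_le_mul_of_nonneg_left (hB _) (by positivity)
      · have := ((tendsto_rpow_neg_atTop hwre).comp
          (tendsto_natCast_atTop_atTop.comp (tendsto_add_atTop_nat 1))).mul_const B
        rw [zero_mul] at this
        exact this
    have h3 := h2.sub hsum.hasSum.tendsto_sum_nat
    rw [zero_sub] at h3
    refine tendsto_nhds_unique (h1.comp (tendsto_add_atTop_nat 1)) (h3.congr fun N => ?_)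
    have := Finset.sum_range_by_parts (fun i => natExp w (i + 1))
      (fun i => b (i + 1) * natExp ε (i + 1)) (N + 1)
    simp only [smul_eq_mul, Nat.add_sub_cancel] at this
    rw [Function.comp_apply, hG, ← this]
    refine Finset.sum_congr rfl fun i _ => ?_
    rw [natExp_add]; ring
  have hsU : s - ε ∈ U := by
    refine ⟨by rw [Complex.sub_re, hεre]; linarith, ?_⟩
    have : s - ε = ⟨s.re / 2, s.im⟩ := by
      apply Complex.ext <;> simp [hε]
      ring
    have h2 : ‖s - ε‖ ≤ ‖s‖ := by
      rw [this, Complex.norm_def, Complex.norm_def]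
      refine Real.sqrt_le_sqrt ?_
      simp only [Complex.normSq_apply]
      nlinarith
    linarith
  have h1 : DifferentiableAt ℂ (fun w => -∑' i, F i w) (s - ε) :=
    (hdiff.differentiableAt (hUo.mem_nhds hsU)).neg
  have h2 : DifferentiableAt ℂ (fun w => D (ε + w)) (s - ε) :=
    h1.congr_of_eventuallyEq ((hUo.mem_nhds hsU) |> fun h => by
      filter_upwards [h] with w hw using heq w hw)
  have h3 : DifferentiableAt ℂ ((fun w => D (ε + w)) ∘ fun z => z - ε) s :=
    DifferentiableAt.comp s h2 (by fun_prop)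
  refine h3.congr_of_eventuallyEq (Eventually.of_forall fun z => ?_)
  simp

/-- Convergence at `1` bounds the terms there; two further units of real part supply the factor
`n^{-2}`. -/
lemma summable_norm_mul_natExp (hb : b 0 = 0)
    (hD : ∀ s : ℂ, 0 < s.re →
      Tendsto (fun N : ℕ => ∑ n ∈ Finset.range N, b n * natExp s n) atTop (𝓝 (D s))) :
    Summable fun n => ‖b n * natExp 3 n‖ := by
  have h1 := hD 1 (by simp)
  have h2 : Tendsto (fun n => b n * natExp 1 n) atTop (𝓝 0) := by
    have := (h1.comp (tendsto_add_atTop_nat 1)).sub h1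
    rw [sub_self] at this
    refine this.congr fun n => ?_
    simp [Finset.sum_range_succ]
  obtain ⟨B, hB⟩ := h2.norm.bddAbove_range
  refine Summable.of_nonneg_of_le (fun _ => norm_nonneg _) (fun n => ?_)
    (((Real.summable_nat_rpow (p := -2)).2 (by norm_num)).mul_left B)
  rcases eq_or_ne n 0 with rfl | hn
  · simp [hb]
  · rw [show (3 : ℂ) = 1 + 2 by norm_num, natExp_add, ← mul_assoc, norm_mul,
      norm_natExp_eq_rpow 2 hn]
    have := hB ⟨n, rfl⟩
    simp only [Complex.re_ofNat]
    gcongr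

end DirichletSeries

/-! ### Mean values on vertical lines -/

/-- The mean value of `f` over `[-T, T]`. -/
noncomputable def symmMean {E : Type*} [NormedAddCommGroup E] [NormedSpace ℝ E] (T : ℝ)
    (f : ℝ → E) : E := (2 * T)⁻¹ • ∫ t in (-T)..T, f t

section Mean

variable {E : Type*} [NormedAddCommGroup E] [NormedSpace ℝ E]

lemma norm_symmMean_le {T C : ℝ} (hT : 0 < T) {f : ℝ → E} (hf : ∀ t, ‖f t‖ ≤ C) :
    ‖symmMean T f‖ ≤ C := by
  rw [symmMean, norm_smul, Real.norm_eq_abs, abs_of_pos (by positivity)]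
  have h := intervalIntegral.norm_integral_le_of_norm_le_const (a := -T) (b := T)
    (fun t _ => hf t)
  rw [show |T - -T| = 2 * T by rw [sub_neg_eq_add, abs_of_pos (by linarith)]; ring] at h
  rw [inv_mul_le_iff₀ (by positivity)]
  linarith

lemma symmMean_sum {ι : Type*} (s : Finset ι) {f : ι → ℝ → E} (hf : ∀ i ∈ s, Continuous (f i))
    (T : ℝ) : symmMean T (fun t => ∑ i ∈ s, f i t) = ∑ i ∈ s, symmMean T (f i) := by
  simp only [symmMean]
  rw [intervalIntegral.integral_finsetSum fun i hi => (hf i hi).intervalIntegrable _ _,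
    Finset.smul_sum]

lemma symmMean_const_mul {𝕜 : Type*} [RCLike 𝕜] (c : 𝕜) (f : ℝ → 𝕜) (T : ℝ) :
    symmMean T (fun t => c * f t) = c * symmMean T f := by
  simp only [symmMean]
  rw [intervalIntegral.integral_const_mul, mul_smul_comm]

lemma symmMean_mono {T : ℝ} (hT : 0 < T) {f g : ℝ → ℝ} (hf : Continuous f) (hg : Continuous g)
    (h : ∀ t, f t ≤ g t) : symmMean T f ≤ symmMean T g := by
  simp only [symmMean, smul_eq_mul]
  refine mul_le_mul_of_nonneg_left ?_ (by positivity)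
  exact intervalIntegral.integral_mono (by linarith) (hf.intervalIntegrable _ _)
    (hg.intervalIntegrable _ _) h

lemma symmMean_add {f g : ℝ → E} (hf : Continuous f) (hg : Continuous g) (T : ℝ) :
    symmMean T (fun t => f t + g t) = symmMean T f + symmMean T g := by
  simp only [symmMean]
  rw [intervalIntegral.integral_add (hf.intervalIntegrable _ _) (hg.intervalIntegrable _ _),
    smul_add]

lemma symmMean_const {T : ℝ} (hT : 0 < T) (c : ℝ) : symmMean T (fun _ => c) = c := by
  simp only [symmMean, intervalIntegral.integral_const, smul_eq_mul]
  field_simp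
  ring

lemma symmMean_ofReal (T : ℝ) (f : ℝ → ℝ) :
    symmMean T (fun t => (f t : ℂ)) = (symmMean T f : ℝ) := by
  simp only [symmMean, intervalIntegral.integral_ofReal, smul_eq_mul, Complex.real_smul,
    Complex.ofReal_mul]

lemma norm_symmMean_mul_le {T C : ℝ} (hT : 0 < T) {f : ℝ → ℂ} {K : ℝ → ℝ} (hK : Continuous K)
    (hK0 : ∀ t, 0 ≤ K t) (hf : ∀ t, ‖f t‖ ≤ C) :
    ‖symmMean T (fun t => f t * (K t : ℂ))‖ ≤ C * symmMean T K := by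
  have hle : ∀ t, ‖f t * (K t : ℂ)‖ ≤ C * K t := fun t => by
    rw [norm_mul, Complex.norm_real, Real.norm_of_nonneg (hK0 t)]
    exact mul_le_mul_of_nonneg_right (hf t) (hK0 t)
  rw [← symmMean_const_mul (𝕜 := ℝ), symmMean, norm_smul, Real.norm_eq_abs,
    abs_of_pos (by positivity), symmMean, smul_eq_mul]
  refine mul_le_mul_of_nonneg_left ?_ (by positivity)
  exact intervalIntegral.norm_integral_le_of_norm_le (by linarith)
    (Eventually.of_forall fun t _ => hle t) ((hK.const_mul C).intervalIntegrable _ _)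

/-- The mean value of a character of the real line. -/
lemma tendsto_symmMean_exp (ω : ℝ) :
    Tendsto (fun T => symmMean T fun t : ℝ => Complex.exp (Complex.I * ω * t)) atTop
      (𝓝 (if ω = 0 then 1 else 0)) := by
  split_ifs with h
  · refine tendsto_const_nhds.congr' ?_
    filter_upwards [eventually_gt_atTop 0] with T hT
    have := symmMean_ofReal T (fun _ => 1)
    rw [symmMean_const hT] at this
    simp only [h]
    simpa using this.symm
  · have hc : Complex.I * ω ≠ 0 := mul_ne_zero Complex.I_ne_zero (by exact_mod_cast h)
    refine squeeze_zero_norm' (a := fun T => T⁻¹ * |ω|⁻¹) ?_ ?_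
    · filter_upwards [eventually_gt_atTop 0] with T hT
      rw [symmMean, integral_exp_mul_complex hc, norm_smul, Real.norm_eq_abs,
        abs_of_pos (by positivity), norm_div, norm_mul, Complex.norm_I, one_mul,
        Complex.norm_real, Real.norm_eq_abs]
      have h2 : ∀ x : ℝ, ‖Complex.exp (Complex.I * ω * x)‖ = 1 := fun x => by
        rw [Complex.norm_exp]; simp
      have : ‖Complex.exp (Complex.I * ω * T) - Complex.exp (Complex.I * ω * ((-T : ℝ) : ℂ))‖ ≤ 2 := by
        refine (norm_sub_le _ _).trans ?_
        rw [h2, h2]; norm_num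
      calc (2 * T)⁻¹ * (‖Complex.exp (Complex.I * ω * T)
            - Complex.exp (Complex.I * ω * ((-T : ℝ) : ℂ))‖ / |ω|)
          ≤ (2 * T)⁻¹ * (2 / |ω|) := by gcongr
        _ = T⁻¹ * |ω|⁻¹ := by field_simp
    · simpa using tendsto_inv_atTop_zero.mul_const (|ω|⁻¹)

lemma norm_exp_I_mul (ω t : ℝ) : ‖Complex.exp (Complex.I * ω * t)‖ = 1 := by
  rw [Complex.norm_exp]; simp

/-- Dominated convergence is used twice: to integrate term by term, and to let `T → ∞` inside the
series. -/
lemma tendsto_symmMean_tsum {c : ℕ → ℂ} (hc : Summable fun n => ‖c n‖) (ω : ℕ → ℝ) :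
    Tendsto (fun T => symmMean T fun t : ℝ => ∑' n, c n * Complex.exp (Complex.I * ω n * t)) atTop
      (𝓝 (∑' n, c n * if ω n = 0 then 1 else 0)) := by
  have hterm : ∀ T : ℝ, 0 < T →
      ∑' n, c n * symmMean T (fun t : ℝ => Complex.exp (Complex.I * ω n * t))
        = symmMean T fun t : ℝ => ∑' n, c n * Complex.exp (Complex.I * ω n * t) := by
    intro T hT
    have h := intervalIntegral.hasSum_integral_of_dominated_convergence
      (μ := MeasureTheory.volume) (a := -T) (b := T)
      (F := fun n (t : ℝ) => c n * Complex.exp (Complex.I * ω n * t))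
      (f := fun t : ℝ => ∑' n, c n * Complex.exp (Complex.I * ω n * t))
      (fun n _ => ‖c n‖)
      (fun n => (by fun_prop : Continuous fun t : ℝ =>
        c n * Complex.exp (Complex.I * ω n * t)).aestronglyMeasurable)
      (fun n => Eventually.of_forall fun t _ => by rw [norm_mul, norm_exp_I_mul, mul_one])
      (Eventually.of_forall fun t _ => hc) intervalIntegrable_const
      (Eventually.of_forall fun t _ => (Summable.of_norm (by
        simpa only [norm_mul, norm_exp_I_mul, mul_one] using hc)).hasSum)
    have h2 := (h.const_smul ((2 * T)⁻¹)).tsum_eq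
    rw [symmMean, ← h2]
    refine tsum_congr fun n => ?_
    rw [← symmMean_const_mul, symmMean]
  have hlim := tendsto_tsum_of_dominated_convergence (𝓕 := atTop) (bound := fun n => ‖c n‖)
    (f := fun (T : ℝ) n => c n * symmMean T (fun t : ℝ => Complex.exp (Complex.I * ω n * t)))
    (g := fun n => c n * if ω n = 0 then 1 else 0) hc
    (fun n => (tendsto_symmMean_exp (ω n)).const_mul (c n))
    (by
      filter_upwards [eventually_gt_atTop 0] with T hT n
      rw [norm_mul]
      exact mul_le_of_le_one_right (norm_nonneg _)
        (norm_symmMean_le hT fun t => (norm_exp_I_mul (ω n) t).le))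
  refine hlim.congr' ?_
  filter_upwards [eventually_gt_atTop 0] with T hT using hterm T hT

/-- The means over two vertical lines of a bounded holomorphic function have the same limit. -/
lemma tendsto_symmMean_of_vertical {G : ℂ → ℂ} {σ τ M : ℝ} {l : ℂ}
    (hG : ∀ s : ℂ, s.re ∈ Set.uIcc σ τ → DifferentiableAt ℂ G s)
    (hM : ∀ s : ℂ, s.re ∈ Set.uIcc σ τ → ‖G s‖ ≤ M)
    (hl : Tendsto (fun T => symmMean T fun t : ℝ => G (τ + t * Complex.I)) atTop (𝓝 l)) :
    Tendsto (fun T => symmMean T fun t : ℝ => G (σ + t * Complex.I)) atTop (𝓝 l) := by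
  have hdiff : Tendsto (fun T => (symmMean T fun t : ℝ => G (τ + t * Complex.I))
      - symmMean T fun t : ℝ => G (σ + t * Complex.I)) atTop (𝓝 0) := by
    refine squeeze_zero_norm' (a := fun T => T⁻¹ * (M * |τ - σ|)) ?_ ?_
    · filter_upwards [eventually_gt_atTop 0] with T hT
      have h := Complex.integral_boundary_rect_eq_zero_of_differentiableOn G
        (⟨σ, -T⟩ : ℂ) (⟨τ, T⟩ : ℂ) (fun s hs => (hG s hs.1).differentiableWithinAt)
      simp only at h
      have hh : ∀ y : ℝ, ‖∫ x in σ..τ, G (x + y * Complex.I)‖ ≤ M * |τ - σ| := fun y =>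
        intervalIntegral.norm_integral_le_of_norm_le_const fun x hx =>
          hM _ (by simpa using Set.uIoc_subset_uIcc hx)
      set X := ∫ y in (-T)..T, G (τ + y * Complex.I)
      set Y := ∫ y in (-T)..T, G (σ + y * Complex.I)
      -- By Cauchy's theorem the two vertical integrals differ by the horizontal ones, which stay
      -- bounded as `T` grows and vanish after division by `2T`.
      have e : X - Y = Complex.I * ((∫ x in σ..τ, G (x + ((-T : ℝ) : ℂ) * Complex.I))
          - ∫ x in σ..τ, G (x + (T : ℂ) * Complex.I)) := by
        simp only [smul_eq_mul] at h
        linear_combination (-Complex.I) * h + (X - Y) * Complex.I_mul_I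
      rw [symmMean, symmMean, ← smul_sub, norm_smul, Real.norm_eq_abs,
        abs_of_pos (by positivity)]
      have hXY : ‖X - Y‖ ≤ 2 * (M * |τ - σ|) := by
        rw [e, norm_mul, Complex.norm_I, one_mul]
        exact (norm_sub_le _ _).trans (by linarith [hh (-T), hh T])
      calc (2 * T)⁻¹ * ‖X - Y‖ ≤ (2 * T)⁻¹ * (2 * (M * |τ - σ|)) := by gcongr
        _ = _ := by field_simp
    · simpa using tendsto_inv_atTop_zero.mul_const (M * |τ - σ|)
  simpa using hl.sub hdiff

end Mean

/-! ### Bohr's coefficient formula -/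

section DirichletSeries

variable {b : ℕ → ℂ} {D : ℂ → ℂ} {C : ℝ}

/-- Bohr's formula for the coefficients of a Dirichlet series bounded on a half-plane. -/
lemma tendsto_symmMean_dirichlet (hb : b 0 = 0)
    (hD : ∀ s : ℂ, 0 < s.re →
      Tendsto (fun N : ℕ => ∑ n ∈ Finset.range N, b n * natExp s n) atTop (𝓝 (D s)))
    (hC : ∀ s : ℂ, 0 < s.re → ‖D s‖ ≤ C) {σ : ℝ} (hσ : 0 < σ) {g h : ℕ} (hg : g ≠ 0)
    (hh : h ≠ 0) :
    Tendsto (fun T => symmMean T fun t : ℝ => D (σ + t * Complex.I)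
        * Complex.exp (Complex.I * ((Real.log g - Real.log h : ℝ) : ℂ) * t)) atTop
      (𝓝 (if h ∣ g then b (g / h) * natExp σ (g / h) else 0)) := by
  have hC0 : 0 ≤ C := (norm_nonneg _).trans (hC 1 (by simp))
  set ω : ℝ := Real.log g - Real.log h with hω
  -- The limit is computed on `Re s = 3`, where the series converges absolutely, and then moved to
  -- `Re s = σ`. The factor `e^{ωs}` extends the character holomorphically and is bounded on the
  -- strip.
  set G : ℂ → ℂ := fun s => D s * Complex.exp (ω * s) with hGdef
  have hre : ∀ s : ℂ, s.re ∈ Set.uIcc σ 3 → 0 < s.re := fun s hs =>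
    (lt_min hσ (by norm_num)).trans_le hs.1
  have hsum := summable_norm_mul_natExp hb hD
  have hseries : ∀ t : ℝ, D (3 + t * Complex.I) * Complex.exp (Complex.I * ω * t)
      = ∑' n, (b n * natExp 3 n) * Complex.exp (Complex.I * ((ω - Real.log n : ℝ) : ℂ) * t) := by
    intro t
    have e : ∀ n : ℕ, b n * natExp (3 + t * Complex.I) n * Complex.exp (Complex.I * ω * t)
        = (b n * natExp 3 n) * Complex.exp (Complex.I * ((ω - Real.log n : ℝ) : ℂ) * t) := by
      intro n
      rw [natExp_add, mul_assoc, mul_assoc, mul_assoc, natExp, natExp, ← Complex.exp_add]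
      push_cast
      ring_nf
    have hs : Summable fun n => b n * natExp (3 + t * Complex.I) n := by
      refine Summable.of_norm (hsum.congr fun n => ?_)
      rw [norm_mul, norm_mul, norm_natExp, norm_natExp]; simp
    rw [← tendsto_nhds_unique hs.hasSum.tendsto_sum_nat (hD _ (by simp)), ← tsum_mul_right]
    exact tsum_congr e
  -- Only the frequency `log n = log g - log h` survives, that is `g = h * n`.
  have h3 := tendsto_symmMean_tsum hsum fun n => ω - Real.log n
  have hlim : (∑' n, b n * natExp 3 n * if ω - Real.log n = 0 then 1 else 0)
      = if h ∣ g then b (g / h) * natExp 3 (g / h) else 0 := by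
    have hiff : ∀ n : ℕ, n ≠ 0 → (ω - Real.log n = 0 ↔ g = h * n) := by
      intro n hn
      have hh' : (0 : ℝ) < h := by positivity
      have hn' : (0 : ℝ) < n := by positivity
      rw [hω, sub_sub, sub_eq_zero, ← Real.log_mul hh'.ne' hn'.ne',
        Real.log_injOn_pos.eq_iff (Set.mem_Ioi.2 (by positivity)) (Set.mem_Ioi.2 (by positivity))]
      norm_cast
    split_ifs with hdvd
    · obtain ⟨k, rfl⟩ := hdvd
      have hk : k ≠ 0 := by rintro rfl; simp at hg
      rw [Nat.mul_div_cancel_left _ (Nat.pos_of_ne_zero hh), tsum_eq_single k]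
      · rw [if_pos ((hiff k hk).2 rfl), mul_one]
      · intro n hnk
        rcases eq_or_ne n 0 with rfl | hn
        · simp [hb]
        · rw [if_neg, mul_zero]
          rw [hiff n hn]
          exact fun h' => hnk (Nat.eq_of_mul_eq_mul_left (Nat.pos_of_ne_zero hh) h').symm
    · refine (tsum_congr fun n => ?_).trans tsum_zero
      rcases eq_or_ne n 0 with rfl | hn
      · simp [hb]
      · rw [if_neg, mul_zero]
        rw [hiff n hn]
        exact fun h' => hdvd ⟨n, h'⟩
  rw [hlim] at h3
  have hτ : Tendsto (fun T => symmMean T fun t : ℝ => G ((3 : ℝ) + t * Complex.I)) atTop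
      (𝓝 (Complex.exp (ω * 3) * if h ∣ g then b (g / h) * natExp 3 (g / h) else 0)) := by
    refine (h3.const_mul (Complex.exp (ω * 3))).congr fun T => ?_
    rw [← symmMean_const_mul]
    congr 1
    funext t
    rw [← hseries, hGdef]
    simp only [mul_add, Complex.exp_add, Complex.ofReal_ofNat]
    ring_nf
  have hσlim := tendsto_symmMean_of_vertical (G := G) (σ := σ) (τ := 3)
    (M := C * Real.exp (|ω| * (σ + 3)))
    (fun s hs => (differentiableAt_of_tendsto hb hD (hre s hs)).mul (by fun_prop))
    (fun s hs => by
      rw [hGdef, norm_mul, Complex.norm_exp, Complex.re_ofReal_mul]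
      refine mul_le_mul (hC s (hre s hs)) (Real.exp_le_exp.2 ?_) (Real.exp_nonneg _) hC0
      have h1 : s.re ≤ σ + 3 := hs.2.trans (max_le (by linarith) (by linarith))
      calc ω * s.re ≤ |ω| * s.re := mul_le_mul_of_nonneg_right (le_abs_self _) (hre s hs).le
        _ ≤ _ := by gcongr) hτ
  have hfin := hσlim.const_mul (Complex.exp (-(ω * σ)))
  have hval : Complex.exp (-(ω * σ)) * (Complex.exp (ω * 3) *
      if h ∣ g then b (g / h) * natExp 3 (g / h) else 0)
      = if h ∣ g then b (g / h) * natExp σ (g / h) else 0 := by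
    split_ifs with hdvd
    · obtain ⟨k, rfl⟩ := hdvd
      have hk : k ≠ 0 := by rintro rfl; simp at hg
      rw [Nat.mul_div_cancel_left _ (Nat.pos_of_ne_zero hh)]
      have : ω = Real.log k := by
        rw [hω, Nat.cast_mul, Real.log_mul (by exact_mod_cast hh) (by exact_mod_cast hk)]; ring
      rw [this, natExp, natExp]
      have e : Complex.exp (-((Real.log k : ℂ) * σ)) * Complex.exp ((Real.log k : ℂ) * 3)
          * Complex.exp (-(3 * (Real.log k : ℂ))) = Complex.exp (-(σ * (Real.log k : ℂ))) := by
        rw [← Complex.exp_add, ← Complex.exp_add]; ring_nf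
      rw [← e]; ring
    · simp
  rw [hval] at hfin
  refine hfin.congr fun T => ?_
  rw [← symmMean_const_mul]
  congr 1
  funext t
  rw [hGdef]
  simp only [mul_add, Complex.exp_add]
  rw [Complex.exp_neg]
  field_simp

end DirichletSeries

/-! ### Parseval's identity and integers with prescribed primes -/

lemma norm_sq_sum_exp {S : Finset ℕ} (c : ℕ → ℂ) (ω : ℕ → ℝ) (t : ℝ) :
    ((‖∑ n ∈ S, c n * Complex.exp (Complex.I * ω n * t)‖ ^ 2 : ℝ) : ℂ)
      = ∑ g ∈ S, ∑ h ∈ S, (c g * (starRingEnd ℂ) (c h))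
          * Complex.exp (Complex.I * ((ω g - ω h : ℝ) : ℂ) * t) := by
  rw [Complex.ofReal_pow, ← Complex.mul_conj', map_sum, Finset.sum_mul_sum]
  refine Finset.sum_congr rfl fun g _ => Finset.sum_congr rfl fun h _ => ?_
  rw [map_mul, ← Complex.exp_conj]
  simp only [map_mul, Complex.conj_I, Complex.conj_ofReal]
  rw [mul_mul_mul_comm, ← Complex.exp_add]
  push_cast
  ring_nf

/-- Parseval's identity for generalized trigonometric polynomials. -/
lemma tendsto_symmMean_norm_sq {S : Finset ℕ} (c : ℕ → ℂ) {ω : ℕ → ℝ} (hω : Set.InjOn ω S) :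
    Tendsto (fun T => symmMean T fun t : ℝ =>
      ‖∑ n ∈ S, c n * Complex.exp (Complex.I * ω n * t)‖ ^ 2) atTop
      (𝓝 (∑ n ∈ S, ‖c n‖ ^ 2)) := by
  have h : Tendsto (fun T => ∑ g ∈ S, ∑ k ∈ S, (c g * (starRingEnd ℂ) (c k)) *
      symmMean T fun t : ℝ => Complex.exp (Complex.I * ((ω g - ω k : ℝ) : ℂ) * t)) atTop
      (𝓝 (∑ g ∈ S, ∑ k ∈ S, (c g * (starRingEnd ℂ) (c k)) * if ω g - ω k = 0 then 1 else 0)) :=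
    tendsto_finsetSum _ fun g _ => tendsto_finsetSum _ fun k _ =>
      (tendsto_symmMean_exp _).const_mul _
  have hval : (∑ g ∈ S, ∑ k ∈ S, (c g * (starRingEnd ℂ) (c k)) * if ω g - ω k = 0 then 1 else 0)
      = ((∑ n ∈ S, ‖c n‖ ^ 2 : ℝ) : ℂ) := by
    rw [Complex.ofReal_sum]
    refine Finset.sum_congr rfl fun g hg => ?_
    rw [Finset.sum_eq_single g]
    · rw [sub_self, if_pos rfl, mul_one, Complex.mul_conj']; push_cast; rfl
    · intro k hk hkg
      rw [if_neg, mul_zero]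
      rw [sub_eq_zero]
      exact fun h' => hkg (hω hk hg h'.symm)
    · exact fun h' => absurd hg h'
  rw [hval] at h
  have h2 := (Complex.continuous_re.tendsto _).comp h
  rw [Complex.ofReal_re] at h2
  refine h2.congr fun T => ?_
  have : symmMean T (fun t : ℝ =>
        ((‖∑ n ∈ S, c n * Complex.exp (Complex.I * ω n * t)‖ ^ 2 : ℝ) : ℂ))
      = ∑ g ∈ S, ∑ k ∈ S, (c g * (starRingEnd ℂ) (c k)) *
        symmMean T fun t : ℝ => Complex.exp (Complex.I * ((ω g - ω k : ℝ) : ℂ) * t) := by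
    simp only [norm_sq_sum_exp]
    rw [symmMean_sum _ fun g _ => by fun_prop]
    refine Finset.sum_congr rfl fun g _ => ?_
    rw [symmMean_sum _ fun g _ => by fun_prop]
    exact Finset.sum_congr rfl fun k _ => symmMean_const_mul _ _ _
  rw [Function.comp_apply, ← this, symmMean_ofReal, Complex.ofReal_re]

lemma log_injOn_of_pos {S : Finset ℕ} (hS : ∀ n ∈ S, n ≠ 0) :
    Set.InjOn (fun n : ℕ => Real.log n) S := by
  intro m hm n hn h
  have hm' := hS m hm
  have hn' := hS n hn
  exact_mod_cast Real.log_injOn_pos (Set.mem_Ioi.2 (by positivity)) (Set.mem_Ioi.2 (by positivity)) h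

/-- The exponents of the primes in `A` range independently over `0, …, M`. The polynomial growth in
`M` makes the sets of divisors asymptotically invariant under multiplication by a fixed element. -/
lemma card_divisors_prod_primes_pow {A : Finset ℕ} (hA : ∀ q ∈ A, q.Prime) (M : ℕ) :
    ((∏ q ∈ A, q) ^ M).divisors.card = (M + 1) ^ A.card := by
  induction A using Finset.induction_on with
  | empty => simp
  | insert q A hq ih =>
    have hqp := hA q (Finset.mem_insert_self _ _)
    have hA' : ∀ p ∈ A, p.Prime := fun p hp => hA p (Finset.mem_insert_of_mem hp)
    have hcop : Nat.Coprime q (∏ p ∈ A, p) := Nat.Coprime.prod_right fun p hp =>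
      (Nat.coprime_primes hqp (hA' p hp)).2 (by rintro rfl; exact hq hp)
    rw [Finset.prod_insert hq, mul_pow, Nat.Coprime.card_divisors_mul (hcop.pow _ _), ih hA',
      Nat.divisors_prime_pow hqp, Finset.card_insert_of_notMem hq, Finset.card_map,
      Finset.card_range, pow_succ']

lemma list_prod_dvd_pow_length {Q : ℕ} (l : List ℕ) (h : ∀ x ∈ l, x ∣ Q) :
    l.prod ∣ Q ^ l.length := by
  induction l with
  | nil => simp
  | cons x l ih =>
    rw [List.prod_cons, List.length_cons, pow_succ']
    exact mul_dvd_mul (h x List.mem_cons_self) (ih fun y hy => h y (List.mem_cons_of_mem _ hy))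

open ArithmeticFunction in
/-- The products of exactly `m` primes from `A`. -/
def homogeneousSmooth (m : ℕ) (A : Finset ℕ) : Finset ℕ :=
  ((∏ q ∈ A, q) ^ m).divisors.filter fun n => cardFactors n = m

open ArithmeticFunction in
lemma mem_homogeneousSmooth {m : ℕ} {A : Finset ℕ} (hA : ∀ q ∈ A, q.Prime) {n : ℕ} :
    n ∈ homogeneousSmooth m A ↔ n ≠ 0 ∧ cardFactors n = m ∧ n.primeFactors ⊆ A := by
  have hQ : ∏ q ∈ A, q ≠ 0 := Finset.prod_ne_zero_iff.2 fun q hq => (hA q hq).ne_zero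
  rw [homogeneousSmooth, Finset.mem_filter, Nat.mem_divisors]
  constructor
  · rintro ⟨⟨hd, h0⟩, hm⟩
    refine ⟨ne_zero_of_dvd_ne_zero h0 hd, hm, fun q hq => ?_⟩
    have hqp := Nat.prime_of_mem_primeFactors hq
    obtain ⟨p, hp, hqp'⟩ := (Prime.dvd_finsetProd_iff hqp.prime _).1
      (hqp.dvd_of_dvd_pow ((Nat.dvd_of_mem_primeFactors hq).trans hd))
    rwa [(Nat.prime_dvd_prime_iff_eq hqp (hA p hp)).1 hqp']
  · rintro ⟨h0, hm, hs⟩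
    refine ⟨⟨?_, pow_ne_zero _ hQ⟩, hm⟩
    rw [cardFactors_apply] at hm
    conv_lhs => rw [← Nat.prod_primeFactorsList h0]
    rw [← hm]
    refine list_prod_dvd_pow_length _ fun q hq => Finset.dvd_prod_of_mem _ (hs ?_)
    exact Nat.mem_primeFactors_iff_mem_primeFactorsList.2 hq

/-! ### Bohr's correspondence -/

section DirichletSeries

variable {b : ℕ → ℂ} {D : ℂ → ℂ} {C : ℝ}

/-- Testing a bounded Dirichlet series against the positive kernel `|∑_{g ∈ G} χ(g) g^{it}|²`. -/
lemma norm_sum_sum_le (hb : b 0 = 0)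
    (hD : ∀ s : ℂ, 0 < s.re →
      Tendsto (fun N : ℕ => ∑ n ∈ Finset.range N, b n * natExp s n) atTop (𝓝 (D s)))
    (hC : ∀ s : ℂ, 0 < s.re → ‖D s‖ ≤ C) {σ : ℝ} (hσ : 0 < σ) {G : Finset ℕ}
    (hG : ∀ g ∈ G, g ≠ 0) (χ : ℕ → ℂ) :
    ‖∑ g ∈ G, ∑ h ∈ G, (χ g * (starRingEnd ℂ) (χ h)) *
      (if h ∣ g then b (g / h) * natExp σ (g / h) else 0)‖ ≤ C * ∑ g ∈ G, ‖χ g‖ ^ 2 := by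
  set K : ℝ → ℝ := fun t =>
    ‖∑ g ∈ G, χ g * Complex.exp (Complex.I * (Real.log g : ℝ) * t)‖ ^ 2 with hK
  have hKc : Continuous K := by fun_prop
  have hDc : Continuous fun t : ℝ => D (σ + t * Complex.I) :=
    continuous_iff_continuousAt.2 fun t =>
      (differentiableAt_of_tendsto hb hD (s := σ + t * Complex.I) (by simpa using hσ)).continuousAt.comp
        (f := fun t : ℝ => (σ + t * Complex.I : ℂ)) (by fun_prop)
  have h1 : Tendsto (fun T => symmMean T K) atTop (𝓝 (∑ g ∈ G, ‖χ g‖ ^ 2)) :=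
    tendsto_symmMean_norm_sq χ (log_injOn_of_pos hG)
  have h2 : Tendsto (fun T => symmMean T fun t : ℝ => D (σ + t * Complex.I) * (K t : ℂ)) atTop
      (𝓝 (∑ g ∈ G, ∑ h ∈ G, (χ g * (starRingEnd ℂ) (χ h)) *
        (if h ∣ g then b (g / h) * natExp σ (g / h) else 0))) := by
    have := tendsto_finsetSum G fun g hg => tendsto_finsetSum G fun h hh =>
      (tendsto_symmMean_dirichlet hb hD hC hσ (hG g hg) (hG h hh)).const_mul
        (χ g * (starRingEnd ℂ) (χ h))
    refine this.congr fun T => ?_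
    have e : ∀ t : ℝ, D (σ + t * Complex.I) * (K t : ℂ)
        = ∑ g ∈ G, ∑ h ∈ G, (χ g * (starRingEnd ℂ) (χ h)) * (D (σ + t * Complex.I)
          * Complex.exp (Complex.I * ((Real.log g - Real.log h : ℝ) : ℂ) * t)) := by
      intro t
      simp only [hK]
      rw [norm_sq_sum_exp χ (fun n => Real.log n) t, Finset.mul_sum]
      refine Finset.sum_congr rfl fun g _ => ?_
      rw [Finset.mul_sum]
      exact Finset.sum_congr rfl fun h _ => by ring
    have hc : ∀ g h : ℕ, Continuous fun t : ℝ => (χ g * (starRingEnd ℂ) (χ h)) *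
        (D (σ + t * Complex.I) *
          Complex.exp (Complex.I * ((Real.log g - Real.log h : ℝ) : ℂ) * t)) :=
      fun g h => continuous_const.mul (hDc.mul (by fun_prop))
    simp only [e]
    rw [symmMean_sum _ fun g _ => continuous_finsetSum _ fun h _ => hc g h]
    refine Finset.sum_congr rfl fun g _ => ?_
    rw [symmMean_sum _ fun h _ => hc g h]
    exact Finset.sum_congr rfl fun h _ => (symmMean_const_mul _ _ _).symm
  refine le_of_tendsto_of_tendsto h2.norm (h1.const_mul C) ?_
  filter_upwards [eventually_gt_atTop 0] with T hT
  exact norm_symmMean_mul_le hT hKc (fun t => sq_nonneg _)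
    fun t => hC _ (by simpa using hσ)

/-- The coefficients of a bounded Dirichlet series are bounded. -/
lemma norm_coeff_le (hb : b 0 = 0)
    (hD : ∀ s : ℂ, 0 < s.re →
      Tendsto (fun N : ℕ => ∑ n ∈ Finset.range N, b n * natExp s n) atTop (𝓝 (D s)))
    (hC : ∀ s : ℂ, 0 < s.re → ‖D s‖ ≤ C) (n : ℕ) : ‖b n‖ ≤ C := by
  have hC0 : 0 ≤ C := (norm_nonneg _).trans (hC 1 (by simp))
  rcases eq_or_ne n 0 with rfl | hn
  · simpa [hb] using hC0
  have h1 : ∀ σ : ℝ, 0 < σ → ‖b n * natExp σ n‖ ≤ C := by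
    intro σ hσ
    have h := tendsto_symmMean_dirichlet hb hD hC hσ hn one_ne_zero
    rw [if_pos (one_dvd n), Nat.div_one] at h
    refine le_of_tendsto h.norm ?_
    filter_upwards [eventually_gt_atTop 0] with T hT
    refine norm_symmMean_le hT fun t => ?_
    rw [norm_mul, norm_exp_I_mul, mul_one]
    exact hC _ (by simpa using hσ)
  have h2 : Tendsto (fun σ : ℝ => ‖b n * natExp σ n‖) (𝓝[>] 0) (𝓝 ‖b n‖) := by
    have hc : Continuous fun σ : ℝ => ‖b n * natExp σ n‖ := by unfold natExp; fun_prop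
    have := (hc.tendsto 0).mono_left (nhdsWithin_le_nhds (s := Set.Ioi 0))
    simpa [natExp] using this
  exact le_of_tendsto h2 (by filter_upwards [self_mem_nhdsWithin] with σ hσ using h1 σ hσ)

open ArithmeticFunction in
/-- Bohr's correspondence: a bounded homogeneous Dirichlet series restricted to finitely many
primes stays bounded when twisted by a completely multiplicative unimodular function. -/
lemma norm_sum_twist_le {m : ℕ} (hb : b 0 = 0) (hbm : ∀ n, b n ≠ 0 → cardFactors n = m)
    (hD : ∀ s : ℂ, 0 < s.re →
      Tendsto (fun N : ℕ => ∑ n ∈ Finset.range N, b n * natExp s n) atTop (𝓝 (D s)))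
    (hC : ∀ s : ℂ, 0 < s.re → ‖D s‖ ≤ C) {A : Finset ℕ} (hA : ∀ q ∈ A, q.Prime) {χ : ℕ → ℂ}
    (hχ : ∀ k l, k ≠ 0 → l ≠ 0 → χ (k * l) = χ k * χ l) (hχ1 : ∀ k, k ≠ 0 → ‖χ k‖ = 1) :
    ‖∑ k ∈ homogeneousSmooth m A, b k * χ k‖ ≤ C := by
  have hC0 : 0 ≤ C := (norm_nonneg _).trans (hC 1 (by simp))
  set Q := ∏ q ∈ A, q with hQdef
  have hQ : Q ≠ 0 := Finset.prod_ne_zero_iff.2 fun q hq => (hA q hq).ne_zero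
  set G : ℕ → Finset ℕ := fun M => (Q ^ M).divisors with hGdef
  have hG0 : ∀ M, ∀ g ∈ G M, g ≠ 0 := fun M g hg => (Nat.pos_of_mem_divisors hg).ne'
  set S := homogeneousSmooth m A with hS
  have hSG : ∀ j, S ⊆ G (j + m) := fun j k hk => by
    have := Finset.mem_of_mem_filter _ hk
    exact Nat.divisors_subset_of_dvd (pow_ne_zero _ hQ) (pow_dvd_pow Q (Nat.le_add_left m j)) this
  -- The Fejér weight of `k`: the proportion of `h` in the box for which `k * h` is still in the
  -- box.
  set ρ : ℕ → ℕ → ℝ := fun j k =>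
    ((((G (j + m)).filter fun h => k * h ∈ G (j + m)).card : ℝ)) / (G (j + m)).card with hρ
  have hcard : ∀ M, ((G M).card : ℝ) = ((M : ℝ) + 1) ^ A.card := fun M => by
    rw [hGdef]; simp only; rw [card_divisors_prod_primes_pow hA]; push_cast; rfl
  have hcard0 : ∀ M, (0 : ℝ) < (G M).card := fun M => by rw [hcard]; positivity
  have hρlim : ∀ k ∈ S, Tendsto (fun j => ρ j k) atTop (𝓝 1) := by
    intro k hk
    have hkd := (Nat.mem_divisors.1 (Finset.mem_of_mem_filter _ hk)).1
    -- If `k ∣ Q^m`, every divisor `h` of `Q^j` satisfies `k * h ∣ Q^(j+m)`; the lower bound is the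
    -- ratio of the two divisor counts.
    have hlow : Tendsto (fun j : ℕ => ((((j + 1 : ℕ) : ℝ)) / (((j + 1 : ℕ) : ℝ) + m)) ^ A.card)
        atTop (𝓝 1) := by
      simpa using ((tendsto_natCast_div_add_atTop (m : ℝ)).comp (tendsto_add_atTop_nat 1)).pow A.card
    refine tendsto_of_tendsto_of_tendsto_of_le_of_le hlow tendsto_const_nhds (fun j => ?_)
      fun j => ?_
    · have hsub : G j ⊆ (G (j + m)).filter fun h => k * h ∈ G (j + m) := by
        intro h hh
        have hd := (Nat.mem_divisors.1 hh).1
        refine Finset.mem_filter.2 ⟨Nat.mem_divisors.2 ⟨hd.trans (pow_dvd_pow Q (by omega)),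
          pow_ne_zero _ hQ⟩, Nat.mem_divisors.2 ⟨?_, pow_ne_zero _ hQ⟩⟩
        rw [add_comm j m, pow_add]
        exact mul_dvd_mul hkd hd
      have hle : ((G j).card : ℝ) ≤ (((G (j + m)).filter fun h => k * h ∈ G (j + m)).card : ℝ) := by
        exact_mod_cast Finset.card_le_card hsub
      simp only [hρ]
      rw [div_pow, le_div_iff₀ (hcard0 _), hcard]
      refine le_trans (le_of_eq ?_) hle
      rw [hcard]
      push_cast
      rw [show (j : ℝ) + m + 1 = j + 1 + m by ring]
      field_simp
    · simp only [hρ]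
      rw [div_le_one (hcard0 _)]
      exact_mod_cast Finset.card_filter_le _ _
  have hF : ∀ σ : ℝ, 0 < σ → ‖∑ k ∈ S, b k * χ k * natExp σ k‖ ≤ C := by
    intro σ hσ
    set F : ℕ → ℂ := fun k => b k * χ k * natExp σ k with hFdef
    have hj : ∀ j, ‖∑ k ∈ S, F k * (ρ j k : ℂ)‖ ≤ C := by
      intro j
      have h := norm_sum_sum_le hb hD hC hσ (hG0 (j + m)) χ
      have hone : ∑ g ∈ G (j + m), ‖χ g‖ ^ 2 = (G (j + m)).card := by
        rw [Finset.sum_congr rfl fun g hg => by rw [hχ1 g (hG0 _ g hg), one_pow]]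
        simp
      rw [hone] at h
      -- Put `g = k * h`: since `χ` is multiplicative and unimodular, `χ g` times the conjugate of
      -- `χ h` is `χ k`, and `k` is counted once for each admissible `h`.
      have e : ∑ g ∈ G (j + m), ∑ h ∈ G (j + m), (χ g * (starRingEnd ℂ) (χ h)) *
          (if h ∣ g then b (g / h) * natExp σ (g / h) else 0)
          = (G (j + m)).card * ∑ k ∈ S, F k * (ρ j k : ℂ) := by
        calc _ = ∑ h ∈ G (j + m), ∑ g ∈ G (j + m) with h ∣ g, F (g / h) := by
              rw [Finset.sum_comm]
              refine Finset.sum_congr rfl fun h hh => ?_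
              rw [Finset.sum_filter]
              refine Finset.sum_congr rfl fun g hg => ?_
              split_ifs with hd
              · obtain ⟨k, rfl⟩ := hd
                have hh0 := hG0 _ h hh
                have hk0 : k ≠ 0 := by rintro rfl; exact hG0 _ _ hg (mul_zero _)
                rw [Nat.mul_div_cancel_left _ (Nat.pos_of_ne_zero hh0), hχ h k hh0 hk0, hFdef,
                  mul_right_comm (χ h), Complex.mul_conj', hχ1 h hh0]
                push_cast; ring
              · rw [mul_zero]
          _ = ∑ h ∈ G (j + m), ∑ k ∈ G (j + m) with k * h ∈ G (j + m), F k := by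
              refine Finset.sum_congr rfl fun h hh => ?_
              have hh0 := Nat.pos_of_ne_zero (hG0 _ h hh)
              refine Finset.sum_bij' (fun g _ => g / h) (fun k _ => k * h) ?_ ?_ ?_ ?_ ?_
              · intro g hg
                obtain ⟨hg1, hg2⟩ := Finset.mem_filter.1 hg
                refine Finset.mem_filter.2 ⟨?_, by rwa [Nat.div_mul_cancel hg2]⟩
                exact Nat.mem_divisors.2 ⟨(Nat.div_dvd_of_dvd hg2).trans (Nat.mem_divisors.1 hg1).1,
                  pow_ne_zero _ hQ⟩
              · intro k hk
                exact Finset.mem_filter.2 ⟨(Finset.mem_filter.1 hk).2, dvd_mul_left _ _⟩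
              · intro g hg
                exact Nat.div_mul_cancel (Finset.mem_filter.1 hg).2
              · intro k hk
                exact Nat.mul_div_cancel _ hh0
              · intro g hg
                rfl
          _ = ∑ k ∈ G (j + m), F k * (((G (j + m)).filter fun h => k * h ∈ G (j + m)).card : ℂ) := by
              simp only [Finset.sum_filter]
              rw [Finset.sum_comm]
              refine Finset.sum_congr rfl fun k _ => ?_
              rw [← Finset.sum_filter, Finset.sum_const, nsmul_eq_mul, mul_comm]
          _ = ∑ k ∈ S, F k * (((G (j + m)).filter fun h => k * h ∈ G (j + m)).card : ℂ) := by
              refine (Finset.sum_subset (hSG j) fun k hk hkS => ?_).symm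
              have : b k = 0 := by
                by_contra hbk
                refine hkS ((mem_homogeneousSmooth hA).2 ⟨hG0 _ k hk, hbm k hbk, fun q hq => ?_⟩)
                have hqp := Nat.prime_of_mem_primeFactors hq
                obtain ⟨p, hp, hqp'⟩ := (Prime.dvd_finsetProd_iff hqp.prime _).1
                  (hqp.dvd_of_dvd_pow ((Nat.dvd_of_mem_primeFactors hq).trans
                    (Nat.mem_divisors.1 hk).1))
                rwa [(Nat.prime_dvd_prime_iff_eq hqp (hA p hp)).1 hqp']
              rw [hFdef]; simp [this]
          _ = _ := by
              rw [Finset.mul_sum]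
              refine Finset.sum_congr rfl fun k _ => ?_
              have : ((G (j + m)).card : ℂ) ≠ 0 := by exact_mod_cast (hcard0 (j + m)).ne'
              simp only [hρ]
              push_cast
              field_simp
      rw [e, norm_mul, Complex.norm_natCast, mul_comm C] at h
      exact le_of_mul_le_mul_left h (hcard0 _)
    have hlim : Tendsto (fun j => ‖∑ k ∈ S, F k * (ρ j k : ℂ)‖) atTop (𝓝 ‖∑ k ∈ S, F k‖) := by
      refine Tendsto.norm (tendsto_finsetSum _ fun k hk => ?_)
      simpa using ((Complex.continuous_ofReal.tendsto _).comp (hρlim k hk)).const_mul (F k)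
    exact le_of_tendsto hlim (Eventually.of_forall hj)
  have h2 : Tendsto (fun σ : ℝ => ‖∑ k ∈ S, b k * χ k * natExp σ k‖) (𝓝[>] 0)
      (𝓝 ‖∑ k ∈ S, b k * χ k‖) := by
    have hc : Continuous fun σ : ℝ => ‖∑ k ∈ S, b k * χ k * natExp σ k‖ := by
      unfold natExp; fun_prop
    have := (hc.tendsto 0).mono_left (nhdsWithin_le_nhds (s := Set.Ioi 0))
    simpa [natExp] using this
  exact le_of_tendsto h2 (by filter_upwards [self_mem_nhdsWithin] with σ hσ using hF σ hσ)

end DirichletSeries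

/-! ### One-variable polynomials on the unit circle -/

section RootsOfUnity

lemma sum_range_pow_of_pow_eq_one {x : ℂ} {M : ℕ} (hx : x ^ M = 1) (hx1 : x ≠ 1) :
    ∑ l ∈ Finset.range M, x ^ l = 0 := by
  rw [geom_sum_eq hx1, hx, sub_self, zero_div]

/-- The coefficients of a polynomial are bounded by its maximum on the unit circle. -/
lemma norm_sum_filter_le {S : Finset ℕ} {m : ℕ} {e : ℕ → ℕ} (he : ∀ k ∈ S, e k ≤ m) (c : ℕ → ℂ)
    {C : ℝ} (h : ∀ z : ℂ, ‖z‖ = 1 → ‖∑ k ∈ S, c k * z ^ e k‖ ≤ C) {j : ℕ} (hj : j ≤ m) :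
    ‖∑ k ∈ S with e k = j, c k‖ ≤ C := by
  have hM : m + 1 ≠ 0 := Nat.succ_ne_zero m
  set ζ : ℂ := Complex.exp (2 * Real.pi * Complex.I / ((m + 1 : ℕ) : ℂ)) with hζ
  have hprim : IsPrimitiveRoot ζ (m + 1) := Complex.isPrimitiveRoot_exp (m + 1) hM
  have hζ1 : ‖ζ‖ = 1 := hprim.norm'_eq_one hM
  -- Discrete Fourier inversion over the `(m+1)`-th roots of unity; the natural exponent `m + 1 - j`
  -- stands for `-j`.
  have key : ∑ l ∈ Finset.range (m + 1), ζ ^ ((m + 1 - j) * l) * ∑ k ∈ S, c k * (ζ ^ l) ^ e k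
      = ((m + 1 : ℕ) : ℂ) * ∑ k ∈ S with e k = j, c k := by
    simp only [Finset.mul_sum]
    rw [Finset.sum_comm, Finset.sum_filter]
    refine Finset.sum_congr rfl fun k hk => ?_
    have e1 : ∀ l, ζ ^ ((m + 1 - j) * l) * (c k * (ζ ^ l) ^ e k)
        = c k * (ζ ^ (m + 1 - j + e k)) ^ l := fun l => by
      rw [← pow_mul, ← pow_mul, add_mul, pow_add, mul_comm l (e k)]; ring
    simp only [e1]
    rw [← Finset.mul_sum]
    split_ifs with hkj
    · rw [hkj, show m + 1 - j + j = m + 1 by omega, hprim.pow_eq_one]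
      simp [mul_comm]
    · rw [sum_range_pow_of_pow_eq_one, mul_zero]
      · rw [← pow_mul, mul_comm, pow_mul, hprim.pow_eq_one, one_pow]
      · intro h1
        rw [hprim.pow_eq_one_iff_dvd] at h1
        have := he k hk
        obtain ⟨a, ha⟩ := h1
        -- The exponent `m + 1 - j + e k` lies between `1` and `2m + 1`, so the only possible
        -- multiple of `m + 1` is `m + 1` itself, which forces `e k = j`.
        rcases a with _ | _ | a
        · omega
        · omega
        · have : (m + 1) * 2 ≤ (m + 1) * (a + 1 + 1) := Nat.mul_le_mul_left _ (by omega)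
          omega
  have hle : ‖((m + 1 : ℕ) : ℂ) * ∑ k ∈ S with e k = j, c k‖ ≤ ((m + 1 : ℕ) : ℝ) * C := by
    rw [← key]
    refine (norm_sum_le_of_le (f := fun l => ζ ^ ((m + 1 - j) * l) * ∑ k ∈ S, c k * (ζ ^ l) ^ e k)
      (n := fun _ => C) _ fun l _ => ?_).trans_eq (by simp)
    rw [norm_mul, norm_pow, hζ1, one_pow, one_mul]
    exact h _ (by rw [norm_pow, hζ1, one_pow])
  rw [norm_mul, Complex.norm_natCast] at hle
  exact le_of_mul_le_mul_left hle (by positivity)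

/-- A Bernstein inequality: the derivative on the unit circle of a polynomial of degree `m`. -/
lemma norm_sum_mul_exponent_le {S : Finset ℕ} {m : ℕ} {e : ℕ → ℕ} (he : ∀ k ∈ S, e k ≤ m)
    (c : ℕ → ℂ) {C : ℝ} (h : ∀ z : ℂ, ‖z‖ = 1 → ‖∑ k ∈ S, c k * z ^ e k‖ ≤ C) :
    ‖∑ k ∈ S, c k * (e k : ℂ)‖ ≤ ((m : ℝ) + 1) ^ 2 * C := by
  have hC0 : 0 ≤ C := (norm_nonneg _).trans (h 1 norm_one)
  have e1 : ∑ k ∈ S, c k * (e k : ℂ)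
      = ∑ j ∈ Finset.range (m + 1), (j : ℂ) * ∑ k ∈ S with e k = j, c k := by
    rw [← Finset.sum_fiberwise_of_maps_to (s := S) (t := Finset.range (m + 1)) (g := e)
      (fun k hk => Finset.mem_range.2 (Nat.lt_succ_of_le (he k hk)))]
    refine Finset.sum_congr rfl fun j _ => ?_
    rw [Finset.mul_sum]
    refine Finset.sum_congr rfl fun k hk => ?_
    rw [(Finset.mem_filter.1 hk).2, mul_comm]
  rw [e1]
  refine (norm_sum_le_of_le (n := fun _ => ((m : ℝ) + 1) * C) _ fun j hj => ?_).trans_eq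
    (by simp; ring)
  have hj' : j ≤ m := Nat.lt_succ_iff.1 (Finset.mem_range.1 hj)
  rw [norm_mul, Complex.norm_natCast]
  refine mul_le_mul ?_ (norm_sum_filter_le he c h hj') (norm_nonneg _) (by positivity)
  have : (j : ℝ) ≤ m := by exact_mod_cast hj'
  linarith

end RootsOfUnity

/-! ### Absolute sums from subset sums -/

/-- Test on the subsets where `c` is nonnegative and where it is negative. The complex version
applies this to real and imaginary parts. -/
lemma sum_abs_le_of_forall_subset {A : Finset ℕ} {c : ℕ → ℝ} {R : ℝ}
    (h : ∀ B ⊆ A, |∑ q ∈ B, c q| ≤ R) : ∑ q ∈ A, |c q| ≤ 2 * R := by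
  rw [← Finset.sum_filter_add_sum_filter_not A fun q => 0 ≤ c q]
  have h1 : ∑ q ∈ A with 0 ≤ c q, |c q| ≤ R := by
    rw [Finset.sum_congr rfl fun q hq => abs_of_nonneg (Finset.mem_filter.1 hq).2]
    exact (le_abs_self _).trans (h _ (Finset.filter_subset _ _))
  have h2 : ∑ q ∈ A with ¬ 0 ≤ c q, |c q| ≤ R := by
    rw [Finset.sum_congr rfl fun q hq => abs_of_neg (not_le.1 (Finset.mem_filter.1 hq).2),
      Finset.sum_neg_distrib]
    exact (neg_le_abs _).trans (h _ (Finset.filter_subset _ _))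
  linarith

lemma sum_norm_le_of_forall_subset {A : Finset ℕ} {c : ℕ → ℂ} {R : ℝ}
    (h : ∀ B ⊆ A, ‖∑ q ∈ B, c q‖ ≤ R) : ∑ q ∈ A, ‖c q‖ ≤ 4 * R := by
  have h1 : ∑ q ∈ A, |(c q).re| ≤ 2 * R := sum_abs_le_of_forall_subset fun B hB => by
    rw [← Complex.re_sum]; exact (Complex.abs_re_le_norm _).trans (h B hB)
  have h2 : ∑ q ∈ A, |(c q).im| ≤ 2 * R := sum_abs_le_of_forall_subset fun B hB => by
    rw [← Complex.im_sum]; exact (Complex.abs_im_le_norm _).trans (h B hB)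
  calc ∑ q ∈ A, ‖c q‖ ≤ ∑ q ∈ A, (|(c q).re| + |(c q).im|) :=
        Finset.sum_le_sum fun q _ => Complex.norm_le_abs_re_add_abs_im _
    _ ≤ 4 * R := by rw [Finset.sum_add_distrib]; linarith

-- Compare the factors prime by prime: `e + 1 ≤ 2 ^ e`.
open ArithmeticFunction in
lemma card_divisors_le_two_pow {n : ℕ} (hn : n ≠ 0) : n.divisors.card ≤ 2 ^ cardFactors n := by
  rw [Nat.card_divisors hn, cardFactors_eq_sum_factorization, Finsupp.sum,
    ← Finset.prod_pow_eq_pow_sum, Nat.support_factorization]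
  exact Finset.prod_le_prod' fun p _ => Nat.succ_le_of_lt Nat.lt_two_pow_self

/-! ### Khinchine's inequality by a fourth moment -/

section Khinchine

open ArithmeticFunction

variable {S : Finset ℕ} {m : ℕ}

/-- The fourth moment of a homogeneous Dirichlet polynomial. -/
lemma exists_tendsto_symmMean_norm_pow_four (hS : ∀ n ∈ S, n ≠ 0 ∧ cardFactors n = m)
    (c : ℕ → ℂ) :
    ∃ r ≤ 4 ^ m * (∑ n ∈ S, ‖c n‖ ^ 2) ^ 2, Tendsto (fun T => symmMean T fun t : ℝ =>
      ‖∑ n ∈ S, c n * Complex.exp (Complex.I * (Real.log n : ℝ) * t)‖ ^ 4) atTop (𝓝 r) := by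
  -- `d` collects the coefficients of the squared polynomial, so its fourth moment is a second
  -- moment. An integer with `2m` prime factors has at most `4^m` divisors, which bounds the number
  -- of factorizations in each coefficient.
  set P : Finset ℕ := (S ×ˢ S).image fun p => p.1 * p.2 with hP
  set d : ℕ → ℂ := fun N => ∑ p ∈ S ×ˢ S with p.1 * p.2 = N, c p.1 * c p.2 with hd
  have hmaps : ∀ p ∈ S ×ˢ S, p.1 * p.2 ∈ P := fun p hp => Finset.mem_image_of_mem _ hp
  have hP0 : ∀ N ∈ P, N ≠ 0 ∧ cardFactors N = 2 * m := by
    intro N hN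
    obtain ⟨p, hp, rfl⟩ := Finset.mem_image.1 hN
    obtain ⟨hp1, hp2⟩ := Finset.mem_product.1 hp
    obtain ⟨h1, h1'⟩ := hS _ hp1
    obtain ⟨h2, h2'⟩ := hS _ hp2
    exact ⟨mul_ne_zero h1 h2, by rw [cardFactors_mul h1 h2, h1', h2']; ring⟩
  refine ⟨∑ N ∈ P, ‖d N‖ ^ 2, ?_, ?_⟩
  · have hN : ∀ N ∈ P, ‖d N‖ ^ 2
        ≤ 4 ^ m * ∑ p ∈ S ×ˢ S with p.1 * p.2 = N, ‖c p.1‖ ^ 2 * ‖c p.2‖ ^ 2 := by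
      intro N hN
      obtain ⟨hN0, hNm⟩ := hP0 N hN
      have hcard : (((S ×ˢ S).filter fun p => p.1 * p.2 = N).card : ℝ) ≤ 4 ^ m := by
        have h1 : ((S ×ˢ S).filter fun p => p.1 * p.2 = N).card ≤ N.divisors.card := by
          refine Finset.card_le_card_of_injOn Prod.fst (fun p hp => ?_) fun p hp p' hp' h => ?_
          · have := (Finset.mem_filter.1 hp).2
            exact Nat.mem_divisors.2 ⟨⟨_, this.symm⟩, hN0⟩
          · have h1 := (Finset.mem_filter.1 hp).2
            have h2 := (Finset.mem_filter.1 hp').2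
            have h3 : p.1 ≠ 0 := by rintro h0; rw [h0, zero_mul] at h1; exact hN0 h1.symm
            rw [← h2, ← h] at h1
            exact Prod.ext h (Nat.eq_of_mul_eq_mul_left (Nat.pos_of_ne_zero h3) h1)
        have h2 := h1.trans (card_divisors_le_two_pow hN0)
        rw [hNm, pow_mul] at h2
        exact_mod_cast h2
      calc ‖d N‖ ^ 2 ≤ (∑ p ∈ S ×ˢ S with p.1 * p.2 = N, ‖c p.1 * c p.2‖) ^ 2 :=
            pow_le_pow_left₀ (norm_nonneg _) (norm_sum_le _ _) 2
        _ ≤ ((S ×ˢ S).filter fun p => p.1 * p.2 = N).card *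
            ∑ p ∈ S ×ˢ S with p.1 * p.2 = N, ‖c p.1 * c p.2‖ ^ 2 := sq_sum_le_card_mul_sum_sq
        _ ≤ 4 ^ m * ∑ p ∈ S ×ˢ S with p.1 * p.2 = N, ‖c p.1 * c p.2‖ ^ 2 :=
            mul_le_mul_of_nonneg_right hcard (Finset.sum_nonneg fun _ _ => sq_nonneg _)
        _ = _ := by simp only [norm_mul, mul_pow]
    refine (Finset.sum_le_sum hN).trans_eq ?_
    rw [← Finset.mul_sum, Finset.sum_fiberwise_of_maps_to hmaps, Finset.sum_product, sq,
      Finset.sum_mul_sum]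
  · have h := tendsto_symmMean_norm_sq (S := P) d (log_injOn_of_pos fun N hN => (hP0 N hN).1)
    refine h.congr fun T => ?_
    congr 1
    funext t
    have e : ∑ N ∈ P, d N * Complex.exp (Complex.I * (Real.log N : ℝ) * t)
        = (∑ n ∈ S, c n * Complex.exp (Complex.I * (Real.log n : ℝ) * t)) ^ 2 := by
      rw [sq, Finset.sum_mul_sum, ← Finset.sum_product', ← Finset.sum_fiberwise_of_maps_to hmaps]
      refine Finset.sum_congr rfl fun N hN => ?_
      rw [hd, Finset.sum_mul]
      refine Finset.sum_congr rfl fun p hp => ?_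
      obtain ⟨hp1, rfl⟩ := Finset.mem_filter.1 hp
      obtain ⟨hp1, hp2⟩ := Finset.mem_product.1 hp1
      have h1 := (hS _ hp1).1
      have h2 := (hS _ hp2).1
      rw [mul_mul_mul_comm, ← Complex.exp_add, Nat.cast_mul,
        Real.log_mul (by exact_mod_cast h1) (by exact_mod_cast h2)]
      push_cast
      ring_nf
    rw [e, norm_pow]
    ring

/-- Khinchine's inequality between the first and the second moment of a homogeneous Dirichlet
polynomial. The mean of the absolute value is only bounded from below. -/
lemma exists_tendsto_le_symmMean_norm (hS : ∀ n ∈ S, n ≠ 0 ∧ cardFactors n = m)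
    (c : ℕ → ℂ) :
    ∃ (φ : ℝ → ℝ) (l : ℝ), √(∑ n ∈ S, ‖c n‖ ^ 2) ≤ 2 ^ (m + 2) * l ∧ Tendsto φ atTop (𝓝 l) ∧
      ∀ T, 0 < T → φ T ≤ symmMean T fun t : ℝ =>
        ‖∑ n ∈ S, c n * Complex.exp (Complex.I * (Real.log n : ℝ) * t)‖ := by
  set u : ℝ → ℝ := fun t =>
    ‖∑ n ∈ S, c n * Complex.exp (Complex.I * (Real.log n : ℝ) * t)‖ with hu
  have huc : Continuous u := by fun_prop
  have hu0 : ∀ t, 0 ≤ u t := fun t => norm_nonneg _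
  set L := √(∑ n ∈ S, ‖c n‖ ^ 2) with hL
  have hL2 : L ^ 2 = ∑ n ∈ S, ‖c n‖ ^ 2 :=
    Real.sq_sqrt (Finset.sum_nonneg fun _ _ => sq_nonneg _)
  rcases (Real.sqrt_nonneg (∑ n ∈ S, ‖c n‖ ^ 2)).eq_or_lt with h0 | hLpos
  · refine ⟨fun _ => 0, 0, by rw [hL, ← h0]; simp, tendsto_const_nhds, fun T hT => ?_⟩
    have := symmMean_mono hT continuous_const huc hu0
    rwa [symmMean_const hT] at this
  rw [← hL] at hLpos
  obtain ⟨r, hr, hr4⟩ := exists_tendsto_symmMean_norm_pow_four hS c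
  have hr2 : Tendsto (fun T => symmMean T fun t => u t ^ 2) atTop (𝓝 (L ^ 2)) := by
    rw [hL2]; exact tendsto_symmMean_norm_sq c (log_injOn_of_pos fun n hn => (hS n hn).1)
  -- Truncation level: with `r ≤ 4^m L^4`, the fourth moment divided by `s²` costs at most `L²/4`.
  set s : ℝ := 2 ^ (m + 1) * L with hs
  have hs0 : 0 < s := by positivity
  refine ⟨fun T => s⁻¹ * ((symmMean T fun t => u t ^ 2) - (s ^ 2)⁻¹ * symmMean T fun t => u t ^ 4),
    s⁻¹ * (L ^ 2 - (s ^ 2)⁻¹ * r), ?_, (hr2.sub (hr4.const_mul _)).const_mul _, fun T hT => ?_⟩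
  · rw [← hL2] at hr
    have h1 : (s ^ 2)⁻¹ * r ≤ L ^ 2 / 4 := by
      rw [inv_mul_le_iff₀ (by positivity)]
      refine hr.trans_eq ?_
      rw [hs, show (4 : ℝ) = 2 ^ 2 by norm_num, ← pow_mul]; ring
    have h2 : L ^ 2 / 2 ≤ L ^ 2 - (s ^ 2)⁻¹ * r := by nlinarith [sq_nonneg L]
    calc L = 2 ^ (m + 2) * (s⁻¹ * (L ^ 2 / 2)) := by rw [hs]; field_simp; ring
      _ ≤ _ := by gcongr
  -- If `u ≤ s` the linear term dominates `u²`, otherwise the quartic one does. Averaging gives a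
  -- minorant of the mean of `u` whose limit is known.
  · have hpt : ∀ t, u t ^ 2 ≤ s * u t + (s ^ 2)⁻¹ * u t ^ 4 := by
      intro t
      rcases le_total (u t) s with h | h
      · have : 0 ≤ (s ^ 2)⁻¹ * u t ^ 4 := by positivity
        nlinarith [mul_le_mul_of_nonneg_right h (hu0 t)]
      · have h1 : u t ^ 2 ≤ (s ^ 2)⁻¹ * u t ^ 4 := by
          rw [le_inv_mul_iff₀ (by positivity)]
          nlinarith [pow_le_pow_left₀ hs0.le h 2, sq_nonneg (u t)]
        nlinarith [mul_nonneg hs0.le (hu0 t)]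
    have h1 := symmMean_mono hT (by fun_prop) (by fun_prop) hpt
    rw [symmMean_add (by fun_prop) (by fun_prop), symmMean_const_mul, symmMean_const_mul] at h1
    rw [inv_mul_le_iff₀ hs0]
    linarith

end Khinchine

/-! ### The mixed inequality -/

section DirichletSeries

open ArithmeticFunction

variable {b : ℕ → ℂ} {D : ℂ → ℂ} {C : ℝ} {m : ℕ} {A : Finset ℕ}

lemma sum_factorization_le_cardFactors (k : ℕ) (B : Finset ℕ) :
    ∑ q ∈ B, k.factorization q ≤ cardFactors k := by
  rw [cardFactors_eq_sum_factorization, Finsupp.sum]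
  refine (Finset.sum_le_sum_of_ne_zero fun q _ hq => ?_)
  exact Finsupp.mem_support_iff.2 hq

/-- The partial derivatives of the polynomial attached to a bounded homogeneous Dirichlet series,
summed in absolute value at a point of the torus. -/
lemma sum_norm_sum_factorization_le (hb : b 0 = 0) (hbm : ∀ n, b n ≠ 0 → cardFactors n = m)
    (hD : ∀ s : ℂ, 0 < s.re →
      Tendsto (fun N : ℕ => ∑ n ∈ Finset.range N, b n * natExp s n) atTop (𝓝 (D s)))
    (hC : ∀ s : ℂ, 0 < s.re → ‖D s‖ ≤ C) (hA : ∀ q ∈ A, q.Prime) {χ : ℕ → ℂ}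
    (hχ : ∀ k l, k ≠ 0 → l ≠ 0 → χ (k * l) = χ k * χ l) (hχ1 : ∀ k, k ≠ 0 → ‖χ k‖ = 1) :
    ∑ q ∈ A, ‖∑ k ∈ homogeneousSmooth m A, (b k * k.factorization q) * χ k‖
      ≤ 4 * (((m : ℝ) + 1) ^ 2 * C) := by
  refine sum_norm_le_of_forall_subset fun B _ => ?_
  have h := norm_sum_mul_exponent_le (S := homogeneousSmooth m A) (m := m)
    (e := fun k => ∑ q ∈ B, k.factorization q)
    (fun k hk => (sum_factorization_le_cardFactors k B).trans_eq
      ((mem_homogeneousSmooth hA).1 hk).2.1) (fun k => b k * χ k) (C := C) fun z hz => by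
    -- Multiplying the variables in `B` by `z` is again a completely multiplicative unimodular
    -- twist, so the resulting polynomial in `z`, of degree at most `m`, is bounded by `C`.
    have := norm_sum_twist_le hb hbm hD hC hA (χ := fun k => χ k * z ^ ∑ q ∈ B, k.factorization q)
      (fun k l hk hl => by
        simp only [hχ k l hk hl, Nat.factorization_mul hk hl, Finsupp.add_apply,
          Finset.sum_add_distrib, pow_add]
        ring)
      (fun k hk => by rw [norm_mul, norm_pow, hz, one_pow, hχ1 k hk, mul_one])
    simpa only [mul_assoc] using this
  rw [Finset.sum_comm]
  refine le_of_eq_of_le (congrArg norm (Finset.sum_congr rfl fun k _ => ?_)) h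
  push_cast
  rw [Finset.mul_sum]
  exact Finset.sum_congr rfl fun q _ => by ring

/-- The mixed `ℓ¹(ℓ²)` inequality for the coefficients of a bounded homogeneous Dirichlet series. -/
lemma sum_sqrt_sum_sq_le (hb : b 0 = 0) (hbm : ∀ n, b n ≠ 0 → cardFactors n = m)
    (hD : ∀ s : ℂ, 0 < s.re →
      Tendsto (fun N : ℕ => ∑ n ∈ Finset.range N, b n * natExp s n) atTop (𝓝 (D s)))
    (hC : ∀ s : ℂ, 0 < s.re → ‖D s‖ ≤ C) (hA : ∀ q ∈ A, q.Prime) :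
    ∑ q ∈ A, √(∑ k ∈ homogeneousSmooth m A, ‖b k * k.factorization q‖ ^ 2)
      ≤ 2 ^ (m + 2) * (4 * (((m : ℝ) + 1) ^ 2 * C)) := by
  have hS : ∀ n ∈ homogeneousSmooth m A, n ≠ 0 ∧ cardFactors n = m := fun n hn =>
    ⟨((mem_homogeneousSmooth hA).1 hn).1, ((mem_homogeneousSmooth hA).1 hn).2.1⟩
  choose φ l hl hφ hle using fun q : ℕ =>
    exists_tendsto_le_symmMean_norm hS fun k => b k * k.factorization q
  refine (Finset.sum_le_sum fun q _ => hl q).trans ?_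
  rw [← Finset.mul_sum]
  refine mul_le_mul_of_nonneg_left ?_ (by positivity)
  refine le_of_tendsto (tendsto_finsetSum A fun q _ => hφ q) ?_
  filter_upwards [eventually_gt_atTop 0] with T hT
  refine (Finset.sum_le_sum fun q _ => hle q T hT).trans ?_
  -- The sum over `q` is moved inside the mean, where the pointwise bound is uniform in `t`; here `χ
  -- k = k^{it}`.
  rw [← symmMean_sum _ fun q _ => by fun_prop]
  refine (symmMean_mono hT (by fun_prop) continuous_const fun t => ?_).trans_eq
    (symmMean_const hT _)
  refine sum_norm_sum_factorization_le hb hbm hD hC hA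
    (χ := fun k => Complex.exp (Complex.I * (Real.log k : ℝ) * t)) (fun k l hk hl => ?_)
    (fun k _ => norm_exp_I_mul _ _)
  rw [← Complex.exp_add, Nat.cast_mul, Real.log_mul (by exact_mod_cast hk) (by exact_mod_cast hl)]
  push_cast
  ring_nf

end DirichletSeries

/-! ### Translation of the hypotheses and conclusion -/

open ArithmeticFunction in
lemma cardFactors_finset_prod {ι : Type*} (s : Finset ι) {f : ι → ℕ} (hf : ∀ i ∈ s, f i ≠ 0) :
    cardFactors (∏ i ∈ s, f i) = ∑ i ∈ s, cardFactors (f i) := by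
  classical
  induction s using Finset.induction_on with
  | empty => simp
  | insert i s hi ih =>
    have h := fun j hj => hf j (Finset.mem_insert_of_mem hj)
    rw [Finset.prod_insert hi, Finset.sum_insert hi, cardFactors_mul
      (hf i (Finset.mem_insert_self _ _)) (Finset.prod_ne_zero_iff.2 h), ih h]

open ArithmeticFunction in
lemma IsHomogeneousDirichlet.cardFactors_eq {m : ℕ} {a : ℕ+ → ℂ}
    (h : IsHomogeneousDirichlet m a) {n : ℕ+} (hn : a n ≠ 0) : cardFactors (n : ℕ) = m := by
  obtain ⟨α, hα, hnα⟩ := h n hn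
  have hp : ∀ k, (Nat.nth Nat.Prime k).Prime := Nat.prime_nth_prime
  rw [hnα, Finsupp.prod, cardFactors_finset_prod _ fun k _ => pow_ne_zero _ (hp k).ne_zero, ← hα]
  exact Finset.sum_congr rfl fun k _ => cardFactors_apply_prime_pow (hp k)

/-- The extension of a family indexed by the positive integers by zero. -/
noncomputable def extendZero (a : ℕ+ → ℂ) (n : ℕ) : ℂ := if h : 0 < n then a ⟨n, h⟩ else 0

lemma extendZero_zero (a : ℕ+ → ℂ) : extendZero a 0 = 0 := by simp [extendZero]

lemma extendZero_coe (a : ℕ+ → ℂ) (n : ℕ+) : extendZero a n = a n := by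
  rw [extendZero, dif_pos n.pos]
  rfl

lemma tendsto_extendZero {a : ℕ+ → ℂ} {s d : ℂ}
    (h : Tendsto (fun N : ℕ+ => ∑ n ∈ Finset.Icc 1 N, a n / (n : ℂ) ^ s) atTop (𝓝 d)) :
    Tendsto (fun N : ℕ => ∑ n ∈ Finset.range N, extendZero a n * natExp s n) atTop (𝓝 d) := by
  have hsum : ∀ N : ℕ+, ∑ n ∈ Finset.Icc 1 N, a n / (n : ℂ) ^ s
      = ∑ n ∈ Finset.range ((N : ℕ) + 1), extendZero a n * natExp s n := by
    intro N
    rw [Finset.sum_range_succ', extendZero_zero, zero_mul, add_zero]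
    refine Finset.sum_bij' (fun n _ => (n : ℕ) - 1) (fun k _ => k.succPNat) ?_ ?_ ?_ ?_ ?_
    · intro n hn
      have h1 : (n : ℕ) ≤ N := (Finset.mem_Icc.1 hn).2
      have := n.pos
      exact Finset.mem_range.2 (by omega)
    · intro k hk
      refine Finset.mem_Icc.2 ⟨one_le, ?_⟩
      rw [← PNat.coe_le_coe, Nat.succPNat_coe]
      exact Finset.mem_range.1 hk
    · intro n _
      exact PNat.succPNat_natPred n
    · intro k _
      simp
    · intro n _
      rw [Nat.sub_add_cancel n.pos, extendZero_coe, natExp_eq_inv_cpow s n.ne_zero, div_eq_mul_inv]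
  have hpn : Tendsto Nat.succPNat atTop atTop :=
    tendsto_atTop_atTop.2 fun N => ⟨N, fun k hk => by
      rw [← PNat.coe_le_coe, Nat.succPNat_coe]; omega⟩
  -- One unit of the shift comes from `N = k + 1`, the other from `Finset.range (N + 1)` containing
  -- `N`.
  rw [← tendsto_add_atTop_iff_nat 2]
  refine (h.comp hpn).congr fun k => ?_
  rw [Function.comp_apply, hsum, Nat.succPNat_coe]

open ArithmeticFunction in
theorem mainTheorem6 (m : ℕ) (hm : 1 ≤ m) (a : ℕ+ → ℂ) (ha : MemHomogeneousHInfty m a) :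
    MemLorentzOne (2 * (m : ℝ) / ((m : ℝ) + 1)) a ∧
      MemLorentzOne (2 * (m : ℝ) / ((m : ℝ) + 1)) (decreasingRearrangement a) := by
  obtain ⟨hhom, D, hD, C, hC⟩ := ha
  have hm' : (0 : ℝ) < m := by exact_mod_cast hm
  have hp : 0 < 2 * (m : ℝ) / ((m : ℝ) + 1) := by positivity
  have hb := extendZero_zero a
  have hbm : ∀ n, extendZero a n ≠ 0 → cardFactors n = m := by
    intro n hn
    rcases Nat.eq_zero_or_pos n with rfl | h
    · exact absurd hb hn
    · have e := extendZero_coe a ⟨n, h⟩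
      rw [PNat.mk_coe] at e
      exact hhom.cardFactors_eq (n := ⟨n, h⟩) (e ▸ hn)
  have hD' := fun s hs => tendsto_extendZero (hD s hs)
  have hbound : ∀ n, ‖a n‖ ≤ C := fun n => by
    rw [← extendZero_coe a n]; exact norm_coeff_le hb hD' hC n
  have key : MemLorentzOne (2 * (m : ℝ) / ((m : ℝ) + 1)) a := by
    refine memLorentzOne_of_forall_sum_le (fun _ => norm_nonneg _) hp (C := C)
      (R := m * (2 ^ (m + 2) * (4 * (((m : ℝ) + 1) ^ 2 * C)))) hbound fun K n hn => ?_
    -- Homogeneity says nothing about indices with zero coefficient; they contribute nothing and are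
    -- dropped.
    set T := (Finset.range K).filter fun k => a (n k) ≠ 0 with hT
    set A := T.biUnion fun k => (n k : ℕ).primeFactors with hA
    have hAp : ∀ q ∈ A, q.Prime := fun q hq => by
      obtain ⟨k, -, hk⟩ := Finset.mem_biUnion.1 hq
      exact Nat.prime_of_mem_primeFactors hk
    have hinj : Set.InjOn (fun k => (n k : ℕ)) T := fun k hk l hl h =>
      hn (Finset.mem_of_mem_filter _ hk) (Finset.mem_of_mem_filter _ hl) (PNat.coe_injective h)
    have hnT : ∀ k ∈ T, (n k : ℕ) ≠ 0 ∧ cardFactors (n k : ℕ) = m ∧ (n k : ℕ).primeFactors ⊆ A :=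
      fun k hk => ⟨(n k).ne_zero, hhom.cardFactors_eq (Finset.mem_filter.1 hk).2,
        Finset.subset_biUnion_of_mem (fun k => (n k : ℕ).primeFactors) hk⟩
    set L : ℕ → ℝ := fun q =>
      √(∑ k ∈ homogeneousSmooth m A, ‖extendZero a k * k.factorization q‖ ^ 2) with hL
    have hLq : ∀ q ∈ A, ∑ k ∈ T with q ∣ n k, ‖a (n k)‖ ^ 2 ≤ L q ^ 2 := by
      intro q hq
      rw [hL, Real.sq_sqrt (Finset.sum_nonneg fun _ _ => sq_nonneg _)]
      calc ∑ k ∈ T with q ∣ n k, ‖a (n k)‖ ^ 2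
          ≤ ∑ k ∈ T with q ∣ n k, ‖extendZero a (n k) * (n k : ℕ).factorization q‖ ^ 2 := by
            refine Finset.sum_le_sum fun k hk => ?_
            rw [extendZero_coe, norm_mul, Complex.norm_natCast]
            -- If `q` divides the index, the factor produced by differentiation is at least `1`.
            refine pow_le_pow_left₀ (norm_nonneg _) (le_mul_of_one_le_right (norm_nonneg _) ?_) 2
            exact_mod_cast (hAp q hq).factorization_pos_of_dvd (n k).ne_zero
              (Finset.mem_filter.1 hk).2
        _ = ∑ j ∈ (T.filter fun k => q ∣ (n k : ℕ)).image (fun k => (n k : ℕ)),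
              ‖extendZero a j * j.factorization q‖ ^ 2 := by
            rw [Finset.sum_image (hinj.mono (Finset.coe_subset.2 (Finset.filter_subset _ _)))]
        _ ≤ _ := by
            refine Finset.sum_le_sum_of_subset_of_nonneg (fun j hj => ?_) fun _ _ _ => sq_nonneg _
            obtain ⟨k, hk, rfl⟩ := Finset.mem_image.1 hj
            exact (mem_homogeneousSmooth hAp).2 (hnT k (Finset.mem_of_mem_filter _ hk))
    have h1 := sum_mul_weight_le hm (fun k => (n k : ℕ)) (fun k => ‖a (n k)‖) L A hAp T hinj hnT
      (fun _ _ => Real.sqrt_nonneg _) hLq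
    have h2 : ∑ q ∈ A, L q ≤ 2 ^ (m + 2) * (4 * (((m : ℝ) + 1) ^ 2 * C)) :=
      sum_sqrt_sum_sq_le hb hbm hD' hC hAp
    refine le_trans (le_of_eq ?_) (h1.trans (mul_le_mul_of_nonneg_left h2 hm'.le))
    rw [hT, Finset.sum_filter_of_ne]
    intro k _ hk h0
    rw [h0, norm_zero, zero_mul] at hk
    exact hk rfl
  exact ⟨key, key.decreasingRearrangement hp⟩
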